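/- Let $M$ be a connected complex manifold of dimension $2$, with holomorphic tangent bundle $T'M$ and induced local coordinates $(z^k,\eta^k)$, $k=1,2$. Let $F:T'M\to[0,\infty)$ be a complex Finsler metric: $F$ is continuous, $L:=F^2$ is smooth on $T'M\setminus\{0\}$, $F(z,\eta)=0$ if and only if $\eta=0$, $F(z,\lambda\eta)=|\lambda|F(z,\eta)$ for $\lambda\in\mathbb C$, and $g_{i\bar j}:=\partial^2L/\partial\eta^i\partial\bar\eta^j$ is positive definite at every $\eta\ne0$. Put $$N^k_j=g^{\bar mk}\frac{\partial g_{l\bar m}}{\partial z^j}\eta^l,\quad \delta_k=\frac{\partial}{\partial z^k}-N^j_k\frac{\partial}{\partial\eta^j},\quad \delta_{\bar k}=\overline{\delta_k},\quad L^i_{jk}=g^{\bar li}\delta_kg_{j\bar l},\quad C^i_{jk}=g^{\bar li}\frac{\partial g_{j\bar l}}{\partial\eta^k},\quad T^i_{jk}=L^i_{jk}-L^i_{kj},$$ $$R^i_{j\bar hk}=-\delta_{\bar h}L^i_{jk}-\delta_{\bar h}(N^l_k)\,C^i_{jl},\qquad R_{\bar rj\bar hk}=g_{l\bar r}R^l_{j\bar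 hk},$$ an index $0$ (resp. $\bar 0$) denoting contraction with $\eta$ (resp. $\bar\eta$). With $l^i=\eta^i/F$, $l_i=\frac1Fg_{i\bar j}\bar\eta^j$, $m^1=-l_2/\sqrt{\det(g_{i\bar j})}$ and $m^2=l_1/\sqrt{\det(g_{i\bar j})}$, put $$A=m^jm^kl_hC^h_{kj},\qquad J=l^jl^kl_iL^i_{jk},\qquad \mathbf K=-\frac1F\,\bar\eta^h\delta_{\bar h}J,$$ where $|A|$ and $\mathbf K$ do not depend on the chart. Assume that 1. $F$ is weakly Kähler: $g_{i\bar l}T^i_{jk}\eta^j\bar\eta^l=0$ for all $k$; 2. $R_{\bar0k\bar00}=R_{\bar00\bar0k}$ for all $k$; 3. $A$ does not vanish identically on $T'U\setminus\{0\}$ for any nonempty open set $U\subseteq M$ (in particular, this holds whenever $|A|\neq0$ at the points of a dense subset of $T'M\setminus\{0\}$). Then there is a real constant $c$ such that $\mathbf K=c$ at every point of $T'M\setminus\{0\}$. Equivalently, the horizontal holomorphic sectional curvature $2R_{\bar rj\bar hk}\,\overline{l^r}\,l^j\,\overline{l^h}\,l^k$ in the direction $\lambda=l^i\delta_i$ is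 equal to $2c$ at every point of $T'M\setminus\{0\}$. -/

import Mathlib

open scoped Manifold ContDiff ComplexOrder

noncomputable section

namespace CFinsler

/-- The model space of complex dimension two. -/
abbrev C2 : Type := Fin 2 → ℂ

/-! ### Wirtinger calculus

Points of `C2 × C2` are pairs `(z, η)` of base coordinates and fibre coordinates. -/

/-- Derivative of type `(1,0)` of `f` at `p` along the complex direction `u`. -/
def wirt (u : C2 × C2) (f : C2 × C2 → ℂ) (p : C2 × C2) : ℂ :=
  (1 / 2) * (fderiv ℝ f p u - Complex.I * fderiv ℝ f p (Complex.I • u))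

/-- Derivative of type `(0,1)` of `f` at `p` along the complex direction `u`. -/
def wirtBar (u : C2 × C2) (f : C2 × C2 → ℂ) (p : C2 × C2) : ℂ :=
  (1 / 2) * (fderiv ℝ f p u + Complex.I * fderiv ℝ f p (Complex.I • u))

/-- `∂f/∂z^k`. -/
def dz (k : Fin 2) (f : C2 × C2 → ℂ) : C2 × C2 → ℂ := wirt (Pi.single k 1, 0) f

/-- The derivative of `f` with respect to the conjugate of `z^k`. -/
def dzBar (k : Fin 2) (f : C2 × C2 → ℂ) : C2 × C2 → ℂ := wirtBar (Pi.single k 1, 0) f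

/-- `∂f/∂η^k`. -/
def dEta (k : Fin 2) (f : C2 × C2 → ℂ) : C2 × C2 → ℂ := wirt (0, Pi.single k 1) f

/-- The derivative of `f` with respect to the conjugate of `η^k`. -/
def dEtaBar (k : Fin 2) (f : C2 × C2 → ℂ) : C2 × C2 → ℂ := wirtBar (0, Pi.single k 1) f

/-! ### Local geometry of the Chern-Finsler connection

`L` is the square of the Finsler function, written in local coordinates `(z, η)`. -/

/-- Fundamental tensor: `gMat L p i j` is the second derivative of `L` with respect to `η^i` and
the conjugate of `η^j`. -/
def gMat (L : C2 × C2 → ℝ) (p : C2 × C2) : Matrix (Fin 2) (Fin 2) ℂ :=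
  Matrix.of fun i j => dEtaBar j (dEta i fun q => (L q : ℂ)) p

/-- The component `g_{i j̄}` as a function. -/
def g (L : C2 × C2 → ℝ) (i j : Fin 2) (p : C2 × C2) : ℂ := gMat L p i j

/-- The component `g^{m̄ k}` of the inverse matrix, so that
`∑ m, g L l m p * gInv L m k p` is the Kronecker symbol. -/
def gInv (L : C2 × C2 → ℝ) (m k : Fin 2) (p : C2 × C2) : ℂ := (gMat L p)⁻¹ m k

/-- Chern-Finsler nonlinear connection: `N L k j` is `N^k_j = g^{m̄ k} (∂g_{l m̄}/∂z^j) η^l`. -/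
def N (L : C2 × C2 → ℝ) (k j : Fin 2) (p : C2 × C2) : ℂ :=
  ∑ m, ∑ l, gInv L m k p * dz j (g L l m) p * p.2 l

/-- Adapted horizontal derivative `δ_k = ∂/∂z^k - N^j_k ∂/∂η^j`. -/
def delta (L : C2 × C2 → ℝ) (k : Fin 2) (f : C2 × C2 → ℂ) (p : C2 × C2) : ℂ :=
  dz k f p - ∑ j, N L j k p * dEta j f p

/-- The conjugate operator of `delta`. -/
def deltaBar (L : C2 × C2 → ℝ) (k : Fin 2) (f : C2 × C2 → ℂ) (p : C2 × C2) : ℂ :=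
  dzBar k f p - ∑ j, star (N L j k p) * dEtaBar j f p

/-- Horizontal coefficients `L^i_{jk} = g^{l̄ i} δ_k g_{j l̄}`. -/
def hCoeff (L : C2 × C2 → ℝ) (i j k : Fin 2) (p : C2 × C2) : ℂ :=
  ∑ l, gInv L l i p * delta L k (g L j l) p

/-- Vertical coefficients `C^i_{jk} = g^{l̄ i} ∂g_{j l̄}/∂η^k`. -/
def vCoeff (L : C2 × C2 → ℝ) (i j k : Fin 2) (p : C2 × C2) : ℂ :=
  ∑ l, gInv L l i p * dEta k (g L j l) p

/-- Horizontal torsion `T^i_{jk} = L^i_{jk} - L^i_{kj}`. -/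
def torsion (L : C2 × C2 → ℝ) (i j k : Fin 2) (p : C2 × C2) : ℂ :=
  hCoeff L i j k p - hCoeff L i k j p

/-- Curvature `R^i_{j h̄ k} = - δ_{h̄} L^i_{jk} - δ_{h̄}(N^l_k) C^i_{jl}`. -/
def curv (L : C2 × C2 → ℝ) (i j h k : Fin 2) (p : C2 × C2) : ℂ :=
  - deltaBar L h (hCoeff L i j k) p - ∑ l, deltaBar L h (N L l k) p * vCoeff L i j l p

/-- Riemann type tensor `R_{r̄ j h̄ k} = g_{l r̄} R^l_{j h̄ k}`. -/
def riem (L : C2 × C2 → ℝ) (r j h k : Fin 2) (p : C2 × C2) : ℂ :=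
  ∑ l, g L l r p * curv L l j h k p

/-- The contraction `R_{0̄ k 0̄ 0}`, an index `0` standing for contraction with `η`. -/
def riem0k00 (L : C2 × C2 → ℝ) (k : Fin 2) (p : C2 × C2) : ℂ :=
  ∑ r, ∑ h, ∑ m, star (p.2 r) * star (p.2 h) * p.2 m * riem L r k h m p

/-- The contraction `R_{0̄ 0 0̄ k}`. -/
def riem000k (L : C2 × C2 → ℝ) (k : Fin 2) (p : C2 × C2) : ℂ :=
  ∑ r, ∑ j, ∑ h, star (p.2 r) * p.2 j * star (p.2 h) * riem L r j h k p

/-- The Finsler function `F`, the square root of `L`. -/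
def Fc (L : C2 × C2 → ℝ) (p : C2 × C2) : ℂ := (Real.sqrt (L p) : ℂ)

/-- `l^i = η^i / F`. -/
def lUp (L : C2 × C2 → ℝ) (i : Fin 2) (p : C2 × C2) : ℂ := p.2 i / Fc L p

/-- `l_i = (1/F) g_{i j̄} η̄^j`. -/
def lDown (L : C2 × C2 → ℝ) (i : Fin 2) (p : C2 × C2) : ℂ :=
  (∑ j, g L i j p * star (p.2 j)) / Fc L p

/-- The square root of the (positive) determinant of the fundamental tensor. -/
def sqrtDet (L : C2 × C2 → ℝ) (p : C2 × C2) : ℂ := (Real.sqrt (gMat L p).det.re : ℂ)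

/-- The second vector of the local complex Berwald frame: `m^1 = -l_2/√g`, `m^2 = l_1/√g`. -/
def mUp (L : C2 × C2 → ℝ) (p : C2 × C2) : C2 :=
  ![- lDown L 1 p / sqrtDet L p, lDown L 0 p / sqrtDet L p]

/-- The vertical term `A = m^j m^k l_h C^h_{kj}`. -/
def termA (L : C2 × C2 → ℝ) (p : C2 × C2) : ℂ :=
  ∑ j, ∑ k, ∑ h, mUp L p j * mUp L p k * lDown L h p * vCoeff L h k j p

/-- The horizontal term `J = l^j l^k l_i L^i_{jk}`. -/
def termJ (L : C2 × C2 → ℝ) (p : C2 × C2) : ℂ :=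
  ∑ i, ∑ j, ∑ k, lUp L j p * lUp L k p * lDown L i p * hCoeff L i j k p

/-- The horizontal curvature invariant `K = -(1/F) J_{|0̄}`, where `J_{|0̄}` is the contraction
of `δ_{h̄} J` with the conjugate of `η^h`. -/
def invK (L : C2 × C2 → ℝ) (p : C2 × C2) : ℂ :=
  - (∑ h, star (p.2 h) * deltaBar L h (termJ L) p) / Fc L p

/-- The horizontal holomorphic sectional curvature `2 R(λ, λ̄, λ, λ̄)` in the direction of the
horizontal unit vector `λ = l^i δ_i`. -/
def holSecCurv (L : C2 × C2 → ℝ) (p : C2 × C2) : ℂ :=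
  2 * ∑ r, ∑ j, ∑ h, ∑ k,
    star (lUp L h p) * star (lUp L r p) * lUp L j p * lUp L k p * riem L r j h k p

/-! ### Complex Finsler surfaces -/

section Manifold

variable (M : Type*) [TopologicalSpace M] [ChartedSpace C2 M]

/-- The holomorphic tangent bundle of a complex surface. -/
abbrev HTangent : Type _ := TangentBundle 𝓘(ℂ, C2) M

/-- The holomorphic charts of a complex surface. -/
abbrev holCharts : Set (OpenPartialHomeomorph M C2) := IsManifold.maximalAtlas 𝓘(ℂ, C2) ω M

variable {M}

/-- The tangent vector `η^i ∂/∂z^i` at the point with coordinates `z` in the chart `e`, for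
`p = (z, η)`. -/
def tangentAt (e : OpenPartialHomeomorph M C2) (p : C2 × C2) : HTangent M :=
  ⟨e.symm p.1, mfderiv 𝓘(ℂ, C2) 𝓘(ℂ, C2) e.symm p.1 p.2⟩

/-- The function `L = F ^ 2` in the local coordinates given by the chart `e`. -/
def localL (F : HTangent M → ℝ) (e : OpenPartialHomeomorph M C2) (p : C2 × C2) : ℝ :=
  F (tangentAt e p) ^ 2

/-- The pairs `(z, η)` with `z` in the image of the chart `e` and `η ≠ 0`. -/
def slitDomain (e : OpenPartialHomeomorph M C2) : Set (C2 × C2) :=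
  {p | p.1 ∈ e.target ∧ p.2 ≠ 0}

/-- `F` is a complex Finsler metric: continuous, with smooth square off the zero section,
positive off the zero section, absolutely homogeneous and strongly pseudoconvex. -/
structure IsComplexFinsler [IsManifold 𝓘(ℂ, C2) ω M] (F : HTangent M → ℝ) : Prop where
  continuous : Continuous F
  smooth : ∀ e ∈ holCharts M, ContDiffOn ℝ ∞ (localL F e) (slitDomain e)
  nonneg : ∀ v, 0 ≤ F v
  eq_zero_iff : ∀ (x : M) (v : TangentSpace 𝓘(ℂ, C2) x), F ⟨x, v⟩ = 0 ↔ v = 0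
  homogeneous : ∀ (x : M) (v : TangentSpace 𝓘(ℂ, C2) x) (c : ℂ), F ⟨x, c • v⟩ = ‖c‖ * F ⟨x, v⟩
  posDef : ∀ e ∈ holCharts M, ∀ p ∈ slitDomain e, (gMat (localL F e) p).PosDef

/-- Weakly Kähler: `g_{i l̄} T^i_{jk} η^j η̄^l = 0`. -/
def IsWeaklyKahler (F : HTangent M → ℝ) : Prop :=
  ∀ e ∈ holCharts M, ∀ p ∈ slitDomain e, ∀ k : Fin 2,
    ∑ i, ∑ j, ∑ l, g (localL F e) i l p * torsion (localL F e) i j k p * p.2 j * star (p.2 l) = 0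

/-- Weak symmetry of the curvature: `R_{0̄ k 0̄ 0} = R_{0̄ 0 0̄ k}`. -/
def IsWeaklySymmetric (F : HTangent M → ℝ) : Prop :=
  ∀ e ∈ holCharts M, ∀ p ∈ slitDomain e, ∀ k : Fin 2,
    riem0k00 (localL F e) k p = riem000k (localL F e) k p

/-- `A` is not identically zero over any nonempty open subset of the surface (a change of
coordinates multiplies `A` by a factor of modulus one, so the chart does not matter). This is
implied by `A` being nonzero on a dense set of nonzero tangent vectors. -/
def IsNonvanishingA (F : HTangent M → ℝ) : Prop :=
  ∀ V : Set M, IsOpen V → V.Nonempty →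
    ∃ e ∈ holCharts M, ∃ p ∈ slitDomain e, e.symm p.1 ∈ V ∧ termA (localL F e) p ≠ 0

end Manifold

end CFinsler

end

/-! In one chart, put Φ = η^k ∂L/∂z^k, N^l_0 = N^l_k η^k and θ^l = η̄^h δ_h̄ N^l_0, so that K L² =
-η̄^h δ_h̄ Φ. For a weakly Kähler metric, R_{0̄k0̄0} - R_{0̄00̄k} = -L_{kl} θ^l with L_{kl} =
∂²L/∂η^k∂η^l, so the curvature hypothesis puts θ in the kernel of this (2,0) Hessian. Homogeneity
puts η there too. In dimension two, wherever the Hessian is nonzero its kernel is the line of η,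
whence θ = -K L η (`θ_eq`). The fibre derivatives of K L² then force ∂K/∂η = 0 (`E_K_eq_zero`), and
the commutation of δ_j with δ_k on Φ̄ forces ∂K/∂z = 0 (`Z_K_eq_zero`). As K is real, dK = 0 there.

Where the Hessian vanishes on an open set, L is a Hermitian form in η and this argument says
nothing, but K L² is then a polynomial of degree at most four in the fibre coordinates. So u = K L²
and w = L² satisfy u⁽⁵⁾ = K w⁽⁵⁾ along vertical lines everywhere: by fibre constancy of K where the
Hessian is nonzero, because both sides vanish where it is locally zero, and by density elsewhere
(`vert_five`). Hence u - c w solves a linear fifth order equation, and one vector with nonzero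
Hessian makes K constant on its whole fibre (`invK_eq_of_fibre`). Since A = (1/F) L_{jk} m^j m^k,
the hypothesis on A gives such vectors over a dense set of base points, and dK = 0 everywhere by
continuity (`fderiv_invK_eq_zero`).

K is independent of the chart because -K L² is the minimum over ξ of the Levi form of L along (η, ξ)
(`FinslerOn.levi_eq`), and Levi forms are invariant under holomorphic maps. Connectedness of C²
minus the origin and of M finishes the proof. -/

noncomputable section

namespace CFinsler

/-! ### The differential algebra of a complex Finsler surface -/

/-- A commutative algebra of "functions of `(z, η)`" with commuting derivations `∂/∂z`, `∂/∂z̄`,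
`∂/∂η`, `∂/∂η̄`, a conjugation, and the square `L` of a complex Finsler function. -/
structure FinslerAlg (A : Type*) [CommRing A] [Algebra ℂ A] where
  conj : A →+* A
  conj_conj : ∀ f, conj (conj f) = f
  Z : Fin 2 → Derivation ℂ A A
  Zb : Fin 2 → Derivation ℂ A A
  E : Fin 2 → Derivation ℂ A A
  Eb : Fin 2 → Derivation ℂ A A
  conj_Z : ∀ k f, conj (Z k f) = Zb k (conj f)
  conj_E : ∀ k f, conj (E k f) = Eb k (conj f)
  Z_Z : ∀ j k f, Z j (Z k f) = Z k (Z j f)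
  Zb_Z : ∀ j k f, Zb j (Z k f) = Z k (Zb j f)
  E_Z : ∀ j k f, E j (Z k f) = Z k (E j f)
  Eb_Z : ∀ j k f, Eb j (Z k f) = Z k (Eb j f)
  E_E : ∀ j k f, E j (E k f) = E k (E j f)
  Eb_E : ∀ j k f, Eb j (E k f) = E k (Eb j f)
  y : Fin 2 → A
  Z_y : ∀ k l, Z k (y l) = 0
  Zb_y : ∀ k l, Zb k (y l) = 0
  E_y : ∀ k l, E k (y l) = if k = l then 1 else 0
  Eb_y : ∀ k l, Eb k (y l) = 0
  L : A
  conj_L : conj L = L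
  euler : ∑ k, y k * E k L = L
  Fi : A
  Fi_sq : Fi * Fi * L = 1
  h : Fin 2 → Fin 2 → A
  g_h : ∀ l k, ∑ m, Eb m (E l L) * h m k = if l = k then 1 else 0
  h_g : ∀ m l, ∑ k, h m k * Eb l (E k L) = if m = l then 1 else 0

namespace FinslerAlg

variable {A : Type*} [CommRing A] [Algebra ℂ A] (S : FinslerAlg A)

/-- The fundamental tensor. -/
def g (i j : Fin 2) : A := S.Eb j (S.E i S.L)

/-- The conjugate fibre coordinates. -/
def yb (k : Fin 2) : A := S.conj (S.y k)

/-- The Chern-Finsler nonlinear connection. -/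
def N (k j : Fin 2) : A := ∑ m, ∑ l, S.h m k * S.Z j (S.g l m) * S.y l

/-- The adapted horizontal derivations. -/
def δ (k : Fin 2) : Derivation ℂ A A := S.Z k - ∑ j, S.N j k • S.E j

/-- The conjugates of the adapted horizontal derivations. -/
def δb (k : Fin 2) : Derivation ℂ A A := S.Zb k - ∑ j, S.conj (S.N j k) • S.Eb j

/-- The contraction of `N` with `η`. -/
def N0 (j : Fin 2) : A := ∑ k, S.N j k * S.y k

/-- The contraction `η^k ∂L/∂z^k`. -/
def Φ : A := ∑ k, S.y k * S.Z k S.L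

/-- The derivation `η̄^h δ_{h̄}`. -/
def δ0 : Derivation ℂ A A := ∑ h, S.yb h • S.δb h

/-- The horizontal curvature invariant. -/
def K : A := - (S.Fi ^ 4 * S.δ0 S.Φ)

/-- The curvature vector `η̄^h δ_{h̄} N^l_0`. -/
def θ (l : Fin 2) : A := S.δ0 (S.N0 l)

lemma δ_apply (k : Fin 2) (f : A) :
    S.δ k f = S.Z k f - (S.N 0 k * S.E 0 f + S.N 1 k * S.E 1 f) := by
  simp [δ, Fin.sum_univ_two, Derivation.sub_apply, Derivation.add_apply]

lemma δb_apply (k : Fin 2) (f : A) :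
    S.δb k f = S.Zb k f - (S.conj (S.N 0 k) * S.Eb 0 f + S.conj (S.N 1 k) * S.Eb 1 f) := by
  simp [δb, Fin.sum_univ_two, Derivation.sub_apply, Derivation.add_apply]

lemma δ0_apply (f : A) : S.δ0 f = S.yb 0 * S.δb 0 f + S.yb 1 * S.δb 1 f := by
  simp [δ0, Fin.sum_univ_two, Derivation.add_apply]

lemma conj_Zb (k : Fin 2) (f : A) : S.conj (S.Zb k f) = S.Z k (S.conj f) := by
  rw [← S.conj_conj (S.Z k (S.conj f)), S.conj_Z, S.conj_conj]

lemma conj_Eb (k : Fin 2) (f : A) : S.conj (S.Eb k f) = S.E k (S.conj f) := by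
  rw [← S.conj_conj (S.E k (S.conj f)), S.conj_E, S.conj_conj]

lemma conj_yb (k : Fin 2) : S.conj (S.yb k) = S.y k := S.conj_conj _

lemma conj_y (k : Fin 2) : S.conj (S.y k) = S.yb k := rfl

lemma conj_injective {f g : A} (h : S.conj f = S.conj g) : f = g := by
  rw [← S.conj_conj f, h, S.conj_conj]

lemma Zb_E (j k : Fin 2) (f : A) : S.Zb j (S.E k f) = S.E k (S.Zb j f) := by
  apply S.conj_injective
  rw [S.conj_Zb, S.conj_E, S.conj_E, S.conj_Zb, S.Eb_Z]

lemma Zb_Eb (j k : Fin 2) (f : A) : S.Zb j (S.Eb k f) = S.Eb k (S.Zb j f) := by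
  apply S.conj_injective
  rw [S.conj_Zb, S.conj_Eb, S.conj_Eb, S.conj_Zb, S.E_Z]

lemma Eb_Eb (j k : Fin 2) (f : A) : S.Eb j (S.Eb k f) = S.Eb k (S.Eb j f) := by
  apply S.conj_injective
  rw [S.conj_Eb, S.conj_Eb, S.conj_Eb, S.conj_Eb, S.E_E]

lemma Z_yb (k l : Fin 2) : S.Z k (S.yb l) = 0 := by
  rw [yb, ← S.conj_Zb, S.Zb_y, map_zero]

lemma E_yb (k l : Fin 2) : S.E k (S.yb l) = 0 := by
  rw [yb, ← S.conj_Eb, S.Eb_y, map_zero]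

lemma Eb_yb (k l : Fin 2) : S.Eb k (S.yb l) = if k = l then 1 else 0 := by
  rw [yb, ← S.conj_E, S.E_y]; split_ifs <;> simp

lemma δ_yb (k l : Fin 2) : S.δ k (S.yb l) = 0 := by
  simp [δ_apply, Z_yb, E_yb]

lemma δb_y (k l : Fin 2) : S.δb k (S.y l) = 0 := by
  simp [δb_apply, Zb_y, Eb_y]

lemma δ0_y (l : Fin 2) : S.δ0 (S.y l) = 0 := by
  simp [δ0_apply, δb_y]

lemma conj_δb (k : Fin 2) (f : A) : S.conj (S.δb k f) = S.δ k (S.conj f) := by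
  simp [δ_apply, δb_apply, S.conj_Zb, S.conj_Eb, S.conj_conj]

lemma conj_g (i j : Fin 2) : S.conj (S.g i j) = S.g j i := by
  rw [g, g, S.conj_Eb, S.conj_E, S.conj_L, S.Eb_E]

lemma euler_two : S.y 0 * S.E 0 S.L + S.y 1 * S.E 1 S.L = S.L := by
  simpa [Fin.sum_univ_two] using S.euler

lemma euler_conj : S.yb 0 * S.Eb 0 S.L + S.yb 1 * S.Eb 1 S.L = S.L := by
  have := congrArg S.conj S.euler_two
  simpa [S.conj_E, S.conj_L, S.conj_y] using this

lemma E_L (i : Fin 2) : S.E i S.L = S.g i 0 * S.yb 0 + S.g i 1 * S.yb 1 := by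
  have := congrArg (S.E i) S.euler_conj
  simp only [map_add, Derivation.leibniz, smul_eq_mul, E_yb, ← S.Eb_E, mul_zero, add_zero] at this
  rw [← this]; simp only [g]; ring

lemma Eb_L (i : Fin 2) : S.Eb i S.L = S.g 0 i * S.y 0 + S.g 1 i * S.y 1 := by
  have := congrArg S.conj (S.E_L i)
  simpa [S.conj_E, S.conj_L, S.conj_g, S.conj_yb] using this

/-- Euler's relation differentiated in η^k: the vector η lies in the kernel of the (2,0) Hessian. -/
lemma y_E_E (k : Fin 2) : S.y 0 * S.E k (S.E 0 S.L) + S.y 1 * S.E k (S.E 1 S.L) = 0 := by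
  have := congrArg (S.E k) S.euler_two
  simp only [map_add, Derivation.leibniz, smul_eq_mul, S.E_y] at this
  fin_cases k <;> simp at this ⊢ <;> linear_combination this

lemma g_h_two (l k : Fin 2) :
    S.g l 0 * S.h 0 k + S.g l 1 * S.h 1 k = if l = k then 1 else 0 := by
  simpa [Fin.sum_univ_two, g] using S.g_h l k

lemma h_g_two (m l : Fin 2) :
    S.h m 0 * S.g 0 l + S.h m 1 * S.g 1 l = if m = l then 1 else 0 := by
  simpa [Fin.sum_univ_two, g] using S.h_g m l

/-- Identities for N are checked after contraction with g, where N becomes a second derivative of L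
(`g_N`). -/
lemma g_nondegenerate {X : Fin 2 → A} (hX : ∀ m, S.g 0 m * X 0 + S.g 1 m * X 1 = 0) (i : Fin 2) :
    X i = 0 := by
  have h0 := S.g_h_two 0 i
  have h1 := S.g_h_two 1 i
  fin_cases i <;> simp at h0 h1 ⊢ <;>
  first
  | linear_combination S.h 0 0 * hX 0 + S.h 1 0 * hX 1 - X 0 * h0 - X 1 * h1
  | linear_combination S.h 0 1 * hX 0 + S.h 1 1 * hX 1 - X 0 * h0 - X 1 * h1

lemma N_eq (k j : Fin 2) : S.N k j = S.h 0 k * S.Z j (S.Eb 0 S.L) + S.h 1 k * S.Z j (S.Eb 1 S.L) := by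
  simp only [S.Eb_L, map_add, Derivation.leibniz, smul_eq_mul, S.Z_y, N, Fin.sum_univ_two]
  ring

lemma g_N (m k : Fin 2) : S.g 0 m * S.N 0 k + S.g 1 m * S.N 1 k = S.Z k (S.Eb m S.L) := by
  rw [S.N_eq, S.N_eq]
  have h0 := S.h_g_two 0 m
  have h1 := S.h_g_two 1 m
  fin_cases m <;> simp at h0 h1 ⊢ <;>
  linear_combination S.Z k (S.Eb 0 S.L) * h0 + S.Z k (S.Eb 1 S.L) * h1

/-- This property characterises N; the horizontal constancy of L and most commutator identities
below come from it. -/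
lemma δ_Eb_L (k m : Fin 2) : S.δ k (S.Eb m S.L) = 0 := by
  rw [S.δ_apply, ← S.g_N, g, g, S.Eb_E, S.Eb_E]; ring

lemma δ_L (k : Fin 2) : S.δ k S.L = 0 := by
  rw [← S.euler_conj]
  simp [S.δ_Eb_L, S.δ_yb, Derivation.leibniz]

lemma δb_E_L (k m : Fin 2) : S.δb k (S.E m S.L) = 0 := by
  apply S.conj_injective
  rw [S.conj_δb, S.conj_E, S.conj_L, S.δ_Eb_L, map_zero]

lemma δb_L (k : Fin 2) : S.δb k S.L = 0 := by
  apply S.conj_injective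
  rw [S.conj_δb, S.conj_L, S.δ_L, map_zero]

lemma δ0_L : S.δ0 S.L = 0 := by simp [δ0_apply, δb_L]

lemma δ0_E_L (m : Fin 2) : S.δ0 (S.E m S.L) = 0 := by simp [δ0_apply, δb_E_L]

lemma E_δ (j k : Fin 2) (f : A) :
    S.E j (S.δ k f) = S.δ k (S.E j f) - (S.E j (S.N 0 k) * S.E 0 f + S.E j (S.N 1 k) * S.E 1 f) := by
  simp only [S.δ_apply, map_sub, map_add, Derivation.leibniz, smul_eq_mul, S.E_Z, S.E_E j]; ring

/-- Comes from applying ∂/∂η^j to `δ_Eb_L`. The left side is L^i_{jk}, so the horizontal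
coefficients are fibre derivatives of N. -/
lemma E_N_eq (i j k : Fin 2) :
    S.h 0 i * S.δ k (S.g j 0) + S.h 1 i * S.δ k (S.g j 1) = S.E j (S.N i k) := by
  have key : ∀ m, S.δ k (S.g j m) =
      S.E j (S.N 0 k) * S.g 0 m + S.E j (S.N 1 k) * S.g 1 m := by
    intro m
    have := S.E_δ j k (S.Eb m S.L)
    rw [S.δ_Eb_L, map_zero] at this
    simp only [g, S.Eb_E]
    linear_combination -this
  rw [key, key]
  have h0 := S.g_h_two 0 i
  have h1 := S.g_h_two 1 i
  fin_cases i <;> simp at h0 h1 ⊢ <;>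
  linear_combination S.E j (S.N 0 k) * h0 + S.E j (S.N 1 k) * h1

lemma y_E_g (i m : Fin 2) : S.y 0 * S.E 0 (S.g i m) + S.y 1 * S.E 1 (S.g i m) = 0 := by
  have := congrArg (S.Eb m) (S.y_E_E i)
  simp only [map_add, Derivation.leibniz, smul_eq_mul, S.Eb_y, map_zero] at this
  simp only [S.E_E i, S.Eb_E _ _ (S.E i S.L)] at this
  simp only [g]
  linear_combination this

/-- N has degree one in η: its contraction with g is ∂²L/∂z^k∂η̄^m, of degree one, and g has degree
zero. -/
lemma y_E_N (i k : Fin 2) : S.y 0 * S.E 0 (S.N i k) + S.y 1 * S.E 1 (S.N i k) = S.N i k := by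
  rw [← sub_eq_zero]
  refine S.g_nondegenerate
    (X := fun i => S.y 0 * S.E 0 (S.N i k) + S.y 1 * S.E 1 (S.N i k) - S.N i k) (fun m => ?_) i
  have h (j : Fin 2) := congrArg (S.E j) (S.g_N m k)
  simp only [map_add, Derivation.leibniz, smul_eq_mul, S.E_Z] at h
  have e := congrArg (fun f => S.Z k (S.Eb m f)) S.euler_two
  simp only [map_add, Derivation.leibniz, smul_eq_mul, S.Eb_y, S.Z_y, S.Eb_E, mul_zero, add_zero]
    at e
  linear_combination S.y 0 * h 0 + S.y 1 * h 1 + e - S.g_N m k -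
    S.N 0 k * S.y_E_g 0 m - S.N 1 k * S.y_E_g 1 m

lemma E_L_N (k : Fin 2) : S.E 0 S.L * S.N 0 k + S.E 1 S.L * S.N 1 k = S.Z k S.L := by
  rw [S.E_L, S.E_L]
  have e := congrArg (S.Z k) S.euler_conj
  simp only [map_add, Derivation.leibniz, smul_eq_mul, S.Z_yb, mul_zero, add_zero] at e
  linear_combination S.yb 0 * S.g_N 0 k + S.yb 1 * S.g_N 1 k + e

lemma Φ_eq : S.Φ = S.E 0 S.L * S.N0 0 + S.E 1 S.L * S.N0 1 := by
  simp only [Φ, N0, Fin.sum_univ_two, ← S.E_L_N]; ring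

lemma g_N0 (m : Fin 2) : S.g 0 m * S.N0 0 + S.g 1 m * S.N0 1 = S.Eb m S.Φ := by
  simp only [N0, Φ, Fin.sum_univ_two, map_add, Derivation.leibniz, smul_eq_mul, S.Eb_y, S.Eb_Z,
    ← S.g_N]
  ring

lemma E_L_θ : S.E 0 S.L * S.θ 0 + S.E 1 S.L * S.θ 1 = S.δ0 S.Φ := by
  simp only [S.Φ_eq, map_add, Derivation.leibniz, smul_eq_mul, S.δ0_E_L, θ]; ring

lemma L_mul_cancel {f : A} (hf : f * S.L = 0) : f = 0 := by
  linear_combination S.Fi * S.Fi * hf - f * S.Fi_sq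

lemma K_L : S.K * S.L ^ 2 = - S.δ0 S.Φ := by
  have h : S.Fi ^ 4 * S.L ^ 2 = 1 := by linear_combination (S.Fi * S.Fi * S.L + 1) * S.Fi_sq
  rw [K]; linear_combination (- S.δ0 S.Φ) * h

end FinslerAlg
end CFinsler
end

/-! ### Reality of K, and its constancy where θ is proportional to η. -/

noncomputable section

namespace CFinsler
namespace FinslerAlg

variable {A : Type*} [CommRing A] [Algebra ℂ A] (S : FinslerAlg A)

/-- The expansion is visibly Hermitian, which makes K real; its terms also show the fibre degree of
K L² when L is quadratic. -/
lemma δ0_Φ : S.δ0 S.Φ =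
    (S.yb 0 * S.y 0 * S.Zb 0 (S.Z 0 S.L) + S.yb 0 * S.y 1 * S.Zb 0 (S.Z 1 S.L) +
      S.yb 1 * S.y 0 * S.Zb 1 (S.Z 0 S.L) + S.yb 1 * S.y 1 * S.Zb 1 (S.Z 1 S.L)) -
    (S.g 0 0 * S.N0 0 * S.conj (S.N0 0) + S.g 0 1 * S.N0 0 * S.conj (S.N0 1) +
      S.g 1 0 * S.N0 1 * S.conj (S.N0 0) + S.g 1 1 * S.N0 1 * S.conj (S.N0 1)) := by
  have h : ∀ k, S.Zb k S.Φ = S.y 0 * S.Zb k (S.Z 0 S.L) + S.y 1 * S.Zb k (S.Z 1 S.L) := by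
    intro k
    simp only [Φ, Fin.sum_univ_two, map_add, Derivation.leibniz, smul_eq_mul, S.Zb_y]; ring
  have hN : ∀ j, S.conj (S.N0 j) = S.conj (S.N j 0) * S.yb 0 + S.conj (S.N j 1) * S.yb 1 := by
    intro j; simp [N0, Fin.sum_univ_two, S.conj_y]
  rw [hN, hN]
  simp only [δ0_apply, δb_apply, h, ← S.g_N0]
  ring

lemma conj_δ0_Φ : S.conj (S.δ0 S.Φ) = S.δ0 S.Φ := by
  simp only [S.δ0_Φ, map_add, map_sub, map_mul, S.conj_conj, S.conj_yb, S.conj_y, S.conj_g,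
    S.conj_Zb, S.conj_Z, S.conj_L, ← S.Zb_Z]
  ring

lemma conj_K : S.conj S.K = S.K := by
  rw [← sub_eq_zero]
  have h := congrArg S.conj S.K_L
  rw [map_neg, S.conj_δ0_Φ, ← S.K_L, map_mul, map_pow, S.conj_L] at h
  exact S.L_mul_cancel (S.L_mul_cancel (by linear_combination h))

/-- The two horizontal derivations of type `(1,0)` commute on functions. -/
lemma δ_δ_sub (j k : Fin 2) (f : A) : S.δ j (S.δ k f) - S.δ k (S.δ j f) =
    - ((S.δ j (S.N 0 k) - S.δ k (S.N 0 j)) * S.E 0 f +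
      (S.δ j (S.N 1 k) - S.δ k (S.N 1 j)) * S.E 1 f) := by
  simp only [S.δ_apply, map_sub, map_add, Derivation.leibniz, smul_eq_mul, S.E_Z, S.Z_Z j k,
    S.E_E 0 1]
  ring

/-- The commutator of δ_j and δ_k is vertical and kills every ∂L/∂η̄^m, so it is zero by
nondegeneracy of g. -/
lemma δ_N (i j k : Fin 2) : S.δ j (S.N i k) = S.δ k (S.N i j) := by
  rw [← sub_eq_zero]
  refine S.g_nondegenerate (X := fun i => S.δ j (S.N i k) - S.δ k (S.N i j)) (fun m => ?_) i
  have := S.δ_δ_sub j k (S.Eb m S.L)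
  simp only [S.δ_Eb_L, map_zero, sub_zero, ← S.Eb_E] at this
  simp only [g]
  linear_combination this

lemma δ_δ (j k : Fin 2) (f : A) : S.δ j (S.δ k f) = S.δ k (S.δ j f) := by
  rw [← sub_eq_zero, S.δ_δ_sub]
  simp [S.δ_N _ j k]

lemma N0_two (i : Fin 2) : S.N0 i = S.N i 0 * S.y 0 + S.N i 1 * S.y 1 := by
  simp [N0, Fin.sum_univ_two]

/-- The weak Kähler condition. -/
def WeaklyKahler : Prop :=
  ∀ k, S.E 0 S.L * S.E k (S.N0 0) + S.E 1 S.L * S.E k (S.N0 1) = 2 * S.Z k S.L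

/-- The weak symmetry of the curvature of a weakly Kähler metric. -/
def CurvatureFlat : Prop :=
  ∀ k, S.E k (S.E 0 S.L) * S.θ 0 + S.E k (S.E 1 S.L) * S.θ 1 = 0

lemma E_δb (j k : Fin 2) (f : A) : S.E j (S.δb k f) = S.δb k (S.E j f) -
    (S.E j (S.conj (S.N 0 k)) * S.Eb 0 f + S.E j (S.conj (S.N 1 k)) * S.Eb 1 f) := by
  simp only [S.δb_apply, map_sub, map_add, Derivation.leibniz, smul_eq_mul, S.Zb_E, ← S.Eb_E]
  ring

lemma Eb_δb (j k : Fin 2) (f : A) : S.Eb j (S.δb k f) = S.δb k (S.Eb j f) -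
    (S.Eb j (S.conj (S.N 0 k)) * S.Eb 0 f + S.Eb j (S.conj (S.N 1 k)) * S.Eb 1 f) := by
  simp only [S.δb_apply, map_sub, map_add, Derivation.leibniz, smul_eq_mul, S.Zb_Eb, S.Eb_Eb j]
  ring

lemma conj_N0 (i : Fin 2) :
    S.conj (S.N0 i) = S.conj (S.N i 0) * S.yb 0 + S.conj (S.N i 1) * S.yb 1 := by
  simp [N0_two, S.conj_y]

lemma E_δ0 (k : Fin 2) (f : A) : S.E k (S.δ0 f) = S.δ0 (S.E k f) -
    (S.E k (S.conj (S.N0 0)) * S.Eb 0 f + S.E k (S.conj (S.N0 1)) * S.Eb 1 f) := by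
  simp only [S.δ0_apply, S.conj_N0, map_add, Derivation.leibniz, smul_eq_mul, S.E_yb, S.E_δb]
  ring

lemma Eb_δ0 (k : Fin 2) (f : A) : S.Eb k (S.δ0 f) = S.δb k f + S.δ0 (S.Eb k f) -
    (S.Eb k (S.conj (S.N0 0)) * S.Eb 0 f + S.Eb k (S.conj (S.N0 1)) * S.Eb 1 f) +
    (S.conj (S.N 0 k) * S.Eb 0 f + S.conj (S.N 1 k) * S.Eb 1 f) := by
  simp only [S.δ0_apply, S.conj_N0, map_add, Derivation.leibniz, smul_eq_mul, S.Eb_yb, S.Eb_δb]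
  fin_cases k <;> simp <;> ring

/-- Fibre derivative of the curvature invariant, for a weakly Kähler metric. -/
lemma E_K (hW : S.WeaklyKahler) (k : Fin 2) :
    S.E k (S.E 0 S.L) * S.θ 0 + S.E k (S.E 1 S.L) * S.θ 1 + 2 * S.δ0 (S.Z k S.L) =
      - (S.E k S.K * S.L ^ 2 + 2 * S.K * S.L * S.E k S.L) := by
  have h := congrArg (S.E k) S.K_L
  -- The weak Kähler condition enters here, producing the factor 2 that later separates this formula
  -- from the conjugate of `Eb_K`.
  have hE : S.E k S.Φ = S.E k (S.E 0 S.L) * S.N0 0 + S.E k (S.E 1 S.L) * S.N0 1 +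
      2 * S.Z k S.L := by
    rw [← hW k, S.Φ_eq]
    simp only [map_add, Derivation.leibniz, smul_eq_mul]; ring
  -- These terms cancel the commutator terms of `E_δ0`, so no derivative of N̄ survives.
  have hd : ∀ l, S.δ0 (S.E k (S.E l S.L)) =
      S.E k (S.conj (S.N0 0)) * S.g l 0 + S.E k (S.conj (S.N0 1)) * S.g l 1 := by
    intro l
    have := S.E_δ0 k (S.E l S.L)
    rw [S.δ0_E_L, map_zero] at this
    simp only [g]; linear_combination -this
  rw [map_neg, S.E_δ0, hE, ← S.g_N0, ← S.g_N0] at h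
  have h2 : S.δ0 (2 * S.Z k S.L) = 2 * S.δ0 (S.Z k S.L) := by
    rw [two_mul, map_add, two_mul]
  simp only [map_add, Derivation.leibniz, smul_eq_mul, hd, h2, pow_two] at h
  simp only [θ]
  linear_combination h

/-- Conjugate fibre derivative of the curvature invariant. -/
lemma Eb_K (k : Fin 2) :
    S.δb k S.Φ + (S.g 0 k * S.θ 0 + S.g 1 k * S.θ 1) =
      - (S.Eb k S.K * S.L ^ 2 + 2 * S.K * S.L * S.Eb k S.L) := by
  have h := congrArg (S.Eb k) S.K_L
  have hd : ∀ l, S.δ0 (S.g l k) = S.g l 0 * (S.Eb k (S.conj (S.N0 0)) - S.conj (S.N 0 k)) +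
      S.g l 1 * (S.Eb k (S.conj (S.N0 1)) - S.conj (S.N 1 k)) := by
    intro l
    have := S.Eb_δ0 k (S.E l S.L)
    rw [S.δ0_E_L, S.δb_E_L, map_zero] at this
    simp only [g]; linear_combination -this
  rw [map_neg, S.Eb_δ0, ← S.g_N0, ← S.g_N0, ← S.g_N0] at h
  simp only [map_add, Derivation.leibniz, smul_eq_mul, hd, pow_two] at h
  simp only [θ]
  linear_combination h

/-- Rests on δ_k(∂L/∂z̄^h) = δ_h̄(∂L/∂z^k): both equal ∂²L/∂z^k∂z̄^h minus the g-pairing of N_k with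
the conjugate of N_h. It makes the conjugate of `Eb_K` comparable with `E_K`. -/
lemma δ0_Z_L (k : Fin 2) : S.conj (S.δb k S.Φ) = S.δ0 (S.Z k S.L) := by
  simp only [S.conj_δb, Φ, Fin.sum_univ_two, map_add, map_mul, S.conj_y, S.conj_Z, S.conj_L,
    Derivation.leibniz, smul_eq_mul, S.δ_yb, mul_zero, add_zero, S.δ0_apply]
  have : ∀ h, S.δ k (S.Zb h S.L) = S.δb h (S.Z k S.L) := by
    intro h
    have e1 : ∀ j, S.E j (S.Zb h S.L) = S.conj (S.Z h (S.Eb j S.L)) := by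
      intro j; rw [S.conj_Z, S.conj_Eb, S.conj_L, S.Zb_E]
    simp only [S.δ_apply, S.δb_apply, e1, S.Eb_Z, ← S.g_N, map_add, map_mul, S.conj_g, S.Zb_Z]
    ring
  rw [this, this]

/-- The factor is found by pairing with ∂L/∂η, which sends θ to -K L² and η to L. -/
lemma θ_eq (hθ : S.θ 0 * S.y 1 = S.θ 1 * S.y 0) (l : Fin 2) : S.θ l = - (S.K * S.L * S.y l) := by
  rw [← sub_eq_zero]
  apply S.L_mul_cancel
  have h1 := S.E_L_θ
  have h2 := S.K_L
  have h3 := S.euler_two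
  fin_cases l <;> simp
  · linear_combination S.y 0 * h1 - S.θ 0 * h3 + S.E 1 S.L * hθ + S.y 0 * h2
  · linear_combination S.y 1 * h1 - S.θ 1 * h3 - S.E 0 S.L * hθ + S.y 1 * h2

/-- For θ = -K L η the Hessian term of `E_K` drops out, and the g-term in the conjugate of `Eb_K`
becomes -K L ∂L/∂η^k. The two resulting values of 2 δ0(∂L/∂z^k) differ by L² ∂K/∂η^k. -/
lemma E_K_eq_zero (hW : S.WeaklyKahler) (hθ : S.θ 0 * S.y 1 = S.θ 1 * S.y 0) (k : Fin 2) :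
    S.E k S.K = 0 := by
  have h1 := S.E_K hW k
  have h2 := congrArg S.conj (S.Eb_K k)
  have h3 := S.y_E_E k
  have h4 := congrArg S.conj (S.Eb_L k)
  simp only [S.θ_eq hθ] at h1 h2
  have h5 : S.conj 2 = 2 := map_ofNat _ 2
  simp only [map_add, map_mul, map_neg, map_pow, S.δ0_Z_L, S.conj_g, S.conj_K, S.conj_L, S.conj_y,
    S.conj_Eb, h5] at h2 h4
  refine S.L_mul_cancel (S.L_mul_cancel ?_)
  linear_combination 2 * h2 - h1 - S.K * S.L * h3 - 2 * S.K * S.L * h4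

lemma Eb_K_eq_zero (hW : S.WeaklyKahler) (hθ : S.θ 0 * S.y 1 = S.θ 1 * S.y 0) (k : Fin 2) :
    S.Eb k S.K = 0 := by
  rw [← S.conj_K, ← S.conj_E, S.E_K_eq_zero hW hθ, map_zero]

lemma δ_E_L (j k : Fin 2) : S.δ j (S.E k S.L) =
    S.E k (S.N 0 j) * S.E 0 S.L + S.E k (S.N 1 j) * S.E 1 S.L := by
  have := S.E_δ k j S.L
  rw [S.δ_L, map_zero] at this
  linear_combination -this

/-- Horizontal constancy. -/
lemma Z_K_eq_zero (hW : S.WeaklyKahler) (hθ : S.θ 0 * S.y 1 = S.θ 1 * S.y 0) (k : Fin 2) :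
    S.Z k S.K = 0 := by
  have hE := S.E_K_eq_zero hW hθ
  have hEb := S.Eb_K_eq_zero hW hθ
  have hZ : ∀ j, S.δ j S.K = S.Z j S.K := by intro j; simp [S.δ_apply, hE]
  have hΦ : ∀ k, S.δ k (S.conj S.Φ) = - (S.K * S.L * S.E k S.L) := by
    intro k
    have h2 := congrArg S.conj (S.Eb_K k)
    have h4 := congrArg S.conj (S.Eb_L k)
    simp only [S.θ_eq hθ, hEb] at h2
    have h5 : S.conj 2 = 2 := map_ofNat _ 2
    simp only [map_add, map_mul, map_neg, map_zero, S.conj_δb, S.conj_g, S.conj_K, S.conj_L,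
      S.conj_y, S.conj_Eb, h5] at h2 h4
    linear_combination h2 - S.K * S.L * h4
  -- Symmetry of the second horizontal derivatives of Φ̄, L being horizontally constant.
  have hsym : ∀ j k, S.Z j S.K * S.L * S.E k S.L + S.K * S.L * S.δ j (S.E k S.L) =
      S.Z k S.K * S.L * S.E j S.L + S.K * S.L * S.δ k (S.E j S.L) := by
    intro j k
    have h := S.δ_δ j k (S.conj S.Φ)
    simp only [hΦ, map_neg, Derivation.leibniz, smul_eq_mul, S.δ_L, hZ] at h
    linear_combination -h
  -- Contract the symmetry with η. By the weak Kähler condition and homogeneity both terms in the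
  -- undifferentiated K become K L ∂L/∂z^j and cancel.
  have hrad : ∀ j, S.Z j S.K * S.L = (S.Z 0 S.K * S.y 0 + S.Z 1 S.K * S.y 1) * S.E j S.L := by
    intro j
    have h0 := hsym j 0
    have h1 := hsym j 1
    simp only [S.δ_E_L] at h0 h1
    have hw := hW j
    simp only [S.N0_two, map_add, Derivation.leibniz, smul_eq_mul, S.E_y] at hw
    have hn := S.E_L_N j
    have h3 := S.euler_two
    have y0 := S.y_E_N 0 j
    have y1 := S.y_E_N 1 j
    rw [← sub_eq_zero]
    apply S.L_mul_cancel
    fin_cases j <;> simp at hw hn h0 h1 h3 y0 y1 ⊢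
    · linear_combination S.y 1 * h1 - S.Z 0 S.K * S.L * h3 + S.K * S.L * hw
        - 2 * S.K * S.L * hn - S.K * S.L * (S.E 0 S.L * y0 + S.E 1 S.L * y1)
    · linear_combination S.y 0 * h0 - S.Z 1 S.K * S.L * h3 + S.K * S.L * hw
        - 2 * S.K * S.L * hn - S.K * S.L * (S.E 0 S.L * y0 + S.E 1 S.L * y1)
  -- Differentiating in η̄^m replaces the rank-one right side by the nondegenerate g.
  have hcross : ∀ j m, S.Z j S.K * S.Eb m S.L =
      (S.Z 0 S.K * S.y 0 + S.Z 1 S.K * S.y 1) * S.g j m := by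
    intro j m
    have h := congrArg (S.Eb m) (hrad j)
    simp only [map_add, Derivation.leibniz, smul_eq_mul, S.Eb_y, S.Eb_Z, hEb, map_zero] at h
    simp only [g]; linear_combination h
  have hdiag : ∀ j i, S.Z j S.K * S.y i =
      (S.Z 0 S.K * S.y 0 + S.Z 1 S.K * S.y 1) * if j = i then 1 else 0 := by
    intro j i
    rw [← S.g_h_two j i]
    have h0 := hcross j 0
    have h1 := hcross j 1
    rw [S.Eb_L] at h0 h1
    have g0 := S.g_h_two 0 i
    have g1 := S.g_h_two 1 i
    fin_cases i <;> simp at g0 g1 ⊢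
    · linear_combination S.h 0 0 * h0 + S.h 1 0 * h1 - S.Z j S.K * (S.y 0 * g0 + S.y 1 * g1)
    · linear_combination S.h 0 1 * h0 + S.h 1 1 * h1 - S.Z j S.K * (S.y 0 * g0 + S.y 1 * g1)
  -- With s the radial derivative, the trace of `hdiag` reads s = 2 s, where 2 is the fibre
  -- dimension.
  have hs : S.Z 0 S.K * S.y 0 + S.Z 1 S.K * S.y 1 = 0 := by
    have h0 := hdiag 0 0
    have h1 := hdiag 1 1
    simp at h0 h1
    linear_combination h0 + h1
  refine S.L_mul_cancel ?_
  rw [hrad, hs, zero_mul]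

lemma Zb_K_eq_zero (hW : S.WeaklyKahler) (hθ : S.θ 0 * S.y 1 = S.θ 1 * S.y 0) (k : Fin 2) :
    S.Zb k S.K = 0 := by
  rw [← S.conj_K, ← S.conj_Z, S.Z_K_eq_zero hW hθ, map_zero]

end FinslerAlg
end CFinsler
end

noncomputable section

namespace CFinsler
namespace FinslerAlg

variable {A : Type*} [CommRing A] [Algebra ℂ A] (S : FinslerAlg A)

/-! ### The coefficients of the Chern-Finsler connection and its curvature -/

/-- The horizontal coefficients. -/
def hC (i j k : Fin 2) : A := ∑ l, S.h l i * S.δ k (S.g j l)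

/-- The vertical coefficients. -/
def vC (i j k : Fin 2) : A := ∑ l, S.h l i * S.E k (S.g j l)

/-- The curvature. -/
def cv (i j h k : Fin 2) : A :=
  - S.δb h (S.hC i j k) - ∑ l, S.δb h (S.N l k) * S.vC i j l

/-- The Riemann type tensor. -/
def rm (r j h k : Fin 2) : A := ∑ l, S.g l r * S.cv l j h k

lemma hC_eq (i j k : Fin 2) : S.hC i j k = S.E j (S.N i k) := by
  simp only [hC, Fin.sum_univ_two, S.E_N_eq]

lemma y_vC (i l : Fin 2) : S.y 0 * S.vC i 0 l + S.y 1 * S.vC i 1 l = 0 := by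
  have h : ∀ m, S.y 0 * S.E l (S.g 0 m) + S.y 1 * S.E l (S.g 1 m) = 0 := by
    intro m
    have := S.y_E_g l m
    simp only [g, ← S.Eb_E, S.E_E l] at this ⊢
    exact this
  simp only [vC, Fin.sum_univ_two]
  linear_combination S.h 0 i * h 0 + S.h 1 i * h 1

/-- Pairing the upper index of C with ∂L/∂η leaves the (2,0) Hessian. This links the Hessian both to
A and to the vertical part of the curvature. -/
lemma E_L_vC (j k : Fin 2) : S.E 0 S.L * S.vC 0 j k + S.E 1 S.L * S.vC 1 j k =
    S.E k (S.E j S.L) := by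
  have h := congrArg (S.E k) (S.E_L j)
  simp only [map_add, Derivation.leibniz, smul_eq_mul, S.E_yb] at h
  have h00 := S.h_g_two 0 0
  have h01 := S.h_g_two 0 1
  have h10 := S.h_g_two 1 0
  have h11 := S.h_g_two 1 1
  simp at h00 h01 h10 h11
  rw [h, S.E_L 0, S.E_L 1]
  simp only [vC, Fin.sum_univ_two]
  linear_combination S.E k (S.g j 0) * (S.yb 0 * h00 + S.yb 1 * h01) +
    S.E k (S.g j 1) * (S.yb 0 * h10 + S.yb 1 * h11)

/-- Apply δ_h̄ to `y_E_N`; the vertical part of the curvature disappears by `y_vC`. -/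
lemma y_cv (i h k : Fin 2) : S.y 0 * S.cv i 0 h k + S.y 1 * S.cv i 1 h k = - S.δb h (S.N i k) := by
  have e := congrArg (S.δb h) (S.y_E_N i k)
  simp only [map_add, Derivation.leibniz, smul_eq_mul, S.δb_y] at e
  simp only [cv, hC_eq, Fin.sum_univ_two]
  linear_combination - e - S.δb h (S.N 0 k) * S.y_vC i 0 - S.δb h (S.N 1 k) * S.y_vC i 1

lemma yb_rm (j h k : Fin 2) : S.yb 0 * S.rm 0 j h k + S.yb 1 * S.rm 1 j h k =
    S.E 0 S.L * S.cv 0 j h k + S.E 1 S.L * S.cv 1 j h k := by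
  rw [S.E_L 0, S.E_L 1]
  simp only [rm, Fin.sum_univ_two]; ring

lemma δb_Z_L (h k : Fin 2) :
    S.E 0 S.L * S.δb h (S.N 0 k) + S.E 1 S.L * S.δb h (S.N 1 k) = S.δb h (S.Z k S.L) := by
  rw [← S.E_L_N k]
  simp only [map_add, Derivation.leibniz, smul_eq_mul, S.δb_E_L]; ring

lemma rm_0_0_h_k (h k : Fin 2) :
    S.yb 0 * (S.y 0 * S.rm 0 0 h k + S.y 1 * S.rm 0 1 h k) +
      S.yb 1 * (S.y 0 * S.rm 1 0 h k + S.y 1 * S.rm 1 1 h k) = - S.δb h (S.Z k S.L) := by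
  linear_combination S.y 0 * S.yb_rm 0 h k + S.y 1 * S.yb_rm 1 h k + S.E 0 S.L * S.y_cv 0 h k +
    S.E 1 S.L * S.y_cv 1 h k - S.δb_Z_L h k

lemma rm_000k (k : Fin 2) :
    ∑ r, ∑ j, ∑ h, S.yb r * S.y j * S.yb h * S.rm r j h k = - S.δ0 (S.Z k S.L) := by
  simp only [Fin.sum_univ_two, S.δ0_apply]
  linear_combination S.yb 0 * S.rm_0_0_h_k 0 k + S.yb 1 * S.rm_0_0_h_k 1 k

/-- The weak Kähler condition identifies the contracted horizontal part up to derivatives of N^l_0,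
and the vertical part brings in the Hessian applied to θ. That Hessian term is the whole discrepancy
with `rm_000k`. -/
lemma rm_0k00 (hW : S.WeaklyKahler) (k : Fin 2) :
    ∑ r, ∑ h, ∑ m, S.yb r * S.yb h * S.y m * S.rm r k h m =
      - S.δ0 (S.Z k S.L) - (S.E k (S.E 0 S.L) * S.θ 0 + S.E k (S.E 1 S.L) * S.θ 1) := by
  have hw := hW k
  have hk : S.E 0 S.L * (S.y 0 * S.E k (S.N 0 0) + S.y 1 * S.E k (S.N 0 1)) +
      S.E 1 S.L * (S.y 0 * S.E k (S.N 1 0) + S.y 1 * S.E k (S.N 1 1)) = S.Z k S.L := by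
    have hn := S.E_L_N k
    simp only [S.N0_two, map_add, Derivation.leibniz, smul_eq_mul, S.E_y] at hw
    fin_cases k <;> simp at hw hn ⊢ <;> linear_combination hw - hn
  have key : ∀ h, S.y 0 * (S.E 0 S.L * S.cv 0 k h 0 + S.E 1 S.L * S.cv 1 k h 0) +
      S.y 1 * (S.E 0 S.L * S.cv 0 k h 1 + S.E 1 S.L * S.cv 1 k h 1) = - S.δb h (S.Z k S.L) -
      (S.E k (S.E 0 S.L) * S.δb h (S.N0 0) + S.E k (S.E 1 S.L) * S.δb h (S.N0 1)) := by
    intro h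
    have e := congrArg (S.δb h) hk
    simp only [map_add, Derivation.leibniz, smul_eq_mul, S.δb_y, S.δb_E_L] at e
    have v0 := S.E_L_vC k 0
    have v1 := S.E_L_vC k 1
    simp only [S.E_E 0 k, S.E_E 1 k] at v0 v1
    simp only [cv, hC_eq, Fin.sum_univ_two, S.N0_two, map_add, Derivation.leibniz, smul_eq_mul,
      S.δb_y]
    linear_combination -e -
      (S.y 0 * S.δb h (S.N 0 0) + S.y 1 * S.δb h (S.N 0 1)) * v0 -
      (S.y 0 * S.δb h (S.N 1 0) + S.y 1 * S.δb h (S.N 1 1)) * v1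
  simp only [Fin.sum_univ_two, S.δ0_apply, θ]
  linear_combination S.yb 0 * key 0 + S.yb 1 * key 1 +
    S.yb 0 * (S.y 0 * S.yb_rm k 0 0 + S.y 1 * S.yb_rm k 0 1) +
    S.yb 1 * (S.y 0 * S.yb_rm k 1 0 + S.y 1 * S.yb_rm k 1 1)

lemma weaklyKahler_of_torsion
    (h : ∀ k, ∑ i, ∑ j, ∑ l, S.g i l * (S.hC i j k - S.hC i k j) * S.y j * S.yb l = 0) :
    S.WeaklyKahler := by
  intro k
  have h := h k
  simp only [hC_eq, Fin.sum_univ_two] at h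
  have e0 := S.E_L 0
  have e1 := S.E_L 1
  have hn := S.E_L_N k
  have y0 := S.y_E_N 0 k
  have y1 := S.y_E_N 1 k
  simp only [S.N0_two, map_add, Derivation.leibniz, smul_eq_mul, S.E_y]
  fin_cases k <;> simp at h hn y0 y1 ⊢
  · rw [e0, e1] at hn ⊢
    linear_combination 2 * hn - h + (S.g 0 0 * S.yb 0 + S.g 0 1 * S.yb 1) * y0 +
      (S.g 1 0 * S.yb 0 + S.g 1 1 * S.yb 1) * y1
  · rw [e0, e1] at hn ⊢
    linear_combination 2 * hn - h + (S.g 0 0 * S.yb 0 + S.g 0 1 * S.yb 1) * y0 +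
      (S.g 1 0 * S.yb 0 + S.g 1 1 * S.yb 1) * y1

lemma curvatureFlat_of_symmetric (hW : S.WeaklyKahler)
    (h : ∀ k, ∑ r, ∑ h, ∑ m, S.yb r * S.yb h * S.y m * S.rm r k h m =
      ∑ r, ∑ j, ∑ h, S.yb r * S.y j * S.yb h * S.rm r j h k) : S.CurvatureFlat := by
  intro k
  have := h k
  rw [S.rm_0k00 hW, S.rm_000k] at this
  linear_combination -this

/-- A is the (2,0) Hessian evaluated on (m, m), up to 1/F, so A ≠ 0 forces a nonzero Hessian. -/
lemma termA_eq (m : Fin 2 → A) :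
    ∑ j, ∑ k, ∑ h, m j * m k * ((∑ l, S.g h l * S.yb l) * S.Fi) * S.vC h k j =
      S.Fi * ∑ j, ∑ k, m j * m k * S.E j (S.E k S.L) := by
  simp only [Fin.sum_univ_two, ← S.E_L, ← S.E_L_vC]; ring

lemma δ0_Fi : S.δ0 S.Fi = 0 := by
  have h := congrArg S.δ0 S.Fi_sq
  simp only [Derivation.leibniz, smul_eq_mul, S.δ0_L, Derivation.map_one_eq_zero] at h
  have h2 : (2 : ℂ) • S.δ0 S.Fi = 0 := by
    rw [two_smul]
    linear_combination S.Fi * h - 2 * S.δ0 S.Fi * S.Fi_sq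
  simpa using h2

/-- The horizontal term `J`. -/
def J : A := ∑ i, ∑ j, ∑ k, (S.y j * S.Fi) * (S.y k * S.Fi) *
  ((∑ l, S.g i l * S.yb l) * S.Fi) * S.hC i j k

lemma J_eq : S.J = S.Fi ^ 3 * S.Φ := by
  rw [S.Φ_eq]
  simp only [J, S.hC_eq, Fin.sum_univ_two, ← S.E_L, S.N0_two]
  linear_combination S.Fi ^ 3 * (S.E 0 S.L * (S.y 0 * S.y_E_N 0 0 + S.y 1 * S.y_E_N 0 1) +
    S.E 1 S.L * (S.y 0 * S.y_E_N 1 0 + S.y 1 * S.y_E_N 1 1))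

/-- Reconciles the two forms of K: J = Φ/F³, and δ0 annihilates 1/F. -/
lemma K_eq_J : S.K = - (∑ h, S.yb h * S.δb h S.J) * S.Fi := by
  have : ∑ h, S.yb h * S.δb h S.J = S.δ0 S.J := by rw [S.δ0_apply, Fin.sum_univ_two]
  rw [this, J_eq, K]
  simp only [Derivation.leibniz, Derivation.leibniz_pow, smul_eq_mul, S.δ0_Fi]
  simp; ring

lemma K_eq_rm : ∑ r, ∑ j, ∑ h, ∑ k, (S.yb h * S.Fi) * (S.yb r * S.Fi) * (S.y j * S.Fi) *
    (S.y k * S.Fi) * S.rm r j h k = S.K := by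
  have h : S.δ0 S.Φ = S.y 0 * S.δ0 (S.Z 0 S.L) + S.y 1 * S.δ0 (S.Z 1 S.L) := by
    simp only [Φ, Fin.sum_univ_two, map_add, Derivation.leibniz, smul_eq_mul, S.δ0_y]; ring
  have h0 := S.rm_000k 0
  have h1 := S.rm_000k 1
  simp only [Fin.sum_univ_two] at h0 h1 ⊢
  rw [K, h]
  linear_combination S.Fi ^ 4 * (S.y 0 * h0 + S.y 1 * h1)

/-- The Levi form of `L` along `(η, ξ)`. -/
lemma levi_eq (ξ ξb : Fin 2 → A) :
    ∑ h, ∑ k, S.yb h * S.y k * S.Zb h (S.Z k S.L) + ∑ k, ∑ l, S.y k * ξb l * S.Eb l (S.Z k S.L) +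
      ∑ h, ∑ l, S.yb h * ξ l * S.Zb h (S.E l S.L) + ∑ i, ∑ j, ξ i * ξb j * S.g i j =
    - (S.K * S.L ^ 2) +
      ∑ i, ∑ j, (ξ i + S.N0 i) * (ξb j + S.conj (S.N0 j)) * S.g i j := by
  -- Mixed derivatives of L are g-pairings with N^i_0, so the terms in ξ complete to a square
  -- centred at -N_0; the remainder is δ0 Φ = -K L².
  have h1 : ∀ l, S.y 0 * S.Z 0 (S.Eb l S.L) + S.y 1 * S.Z 1 (S.Eb l S.L) =
      S.g 0 l * S.N0 0 + S.g 1 l * S.N0 1 := by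
    intro l
    rw [← S.g_N, ← S.g_N, S.N0_two, S.N0_two]; ring
  have h2 : ∀ l, S.yb 0 * S.Zb 0 (S.E l S.L) + S.yb 1 * S.Zb 1 (S.E l S.L) =
      S.g l 0 * S.conj (S.N0 0) + S.g l 1 * S.conj (S.N0 1) := by
    intro l
    have := congrArg S.conj (h1 l)
    simpa only [map_add, map_mul, S.conj_y, S.conj_Z, S.conj_Eb, S.conj_L, S.conj_g] using this
  have h3 := S.δ0_Φ
  have h4 := S.K_L
  simp only [Fin.sum_univ_two, S.Eb_Z]
  linear_combination h4 - h3 + ξb 0 * h1 0 + ξb 1 * h1 1 + ξ 0 * h2 0 + ξ 1 * h2 1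

/-! ### Polynomial dependence on the fibre coordinates -/

/-- `S.DegLT n f` says that `f` is a polynomial of degree less than `n` in the real fibre
coordinates: all its vertical derivatives of order `n` vanish. -/
def DegLT : ℕ → A → Prop
  | 0, f => f = 0
  | n + 1, f => ∀ k, DegLT n (S.E k f) ∧ DegLT n (S.Eb k f)

variable {S}

lemma DegLT.zero : ∀ n, S.DegLT n 0
  | 0 => rfl
  | n + 1 => fun k => by simpa using DegLT.zero n

lemma DegLT.add : ∀ {n} {f g : A}, S.DegLT n f → S.DegLT n g → S.DegLT n (f + g)
  | 0, f, g, hf, hg => by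
    have hf : f = 0 := hf
    have hg : g = 0 := hg
    subst hf; subst hg; simpa using DegLT.zero (S := S) 0
  | n + 1, f, g, hf, hg => fun k => by
    rw [map_add, map_add]
    exact ⟨(hf k).1.add (hg k).1, (hf k).2.add (hg k).2⟩

/-- Induction on the total degree through the Leibniz rule. Differentiating a factor of degree zero
gives bound 0, meaning the zero function, which `right` handles separately. -/
lemma DegLT.mul_aux : ∀ (s m n : ℕ) (f g : A), m + n = s → S.DegLT (m + 1) f →
    S.DegLT (n + 1) g → S.DegLT (s + 1) (f * g) := by
  intro s
  induction s with
  | zero =>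
    intro m n f g hs hf hg k
    obtain ⟨rfl, rfl⟩ : m = 0 ∧ n = 0 := by omega
    have h1 : S.E k f = 0 := (hf k).1
    have h2 : S.E k g = 0 := (hg k).1
    have h3 : S.Eb k f = 0 := (hf k).2
    have h4 : S.Eb k g = 0 := (hg k).2
    simpa [Derivation.leibniz, h1, h2, h3, h4] using DegLT.zero (S := S) 0
  | succ s ih =>
    have right : ∀ (m n : ℕ) (f g : A), m + n = s + 1 → S.DegLT (m + 1) f → S.DegLT n g →
        S.DegLT (s + 1) (f * g) := by
      intro m n f g hs hf hg
      cases n with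
      | zero =>
        have : g = 0 := hg
        simpa [this] using DegLT.zero (S := S) (s + 1)
      | succ n => exact ih m n f g (by omega) hf hg
    intro m n f g hs hf hg k
    rw [Derivation.leibniz, Derivation.leibniz, smul_eq_mul, smul_eq_mul, smul_eq_mul, smul_eq_mul]
    exact ⟨(right m n _ _ hs hf (hg k).1).add (right n m _ _ (by omega) hg (hf k).1),
      (right m n _ _ hs hf (hg k).2).add (right n m _ _ (by omega) hg (hf k).2)⟩

lemma DegLT.mul {m n : ℕ} {f g : A} (hf : S.DegLT (m + 1) f) (hg : S.DegLT (n + 1) g) :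
    S.DegLT (m + n + 1) (f * g) := DegLT.mul_aux _ m n f g rfl hf hg

lemma DegLT.conj : ∀ {n} {f : A}, S.DegLT n f → S.DegLT n (S.conj f)
  | 0, f, hf => by
    have hf : f = 0 := hf
    subst hf; simpa using DegLT.zero (S := S) 0
  | n + 1, f, hf => fun k => by
    rw [← S.conj_Eb, ← S.conj_E]
    exact ⟨(hf k).2.conj, (hf k).1.conj⟩

lemma DegLT.map (D : A → A) (h0 : D 0 = 0) (hE : ∀ k f, S.E k (D f) = D (S.E k f))
    (hEb : ∀ k f, S.Eb k (D f) = D (S.Eb k f)) :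
    ∀ {n} {f : A}, S.DegLT n f → S.DegLT n (D f)
  | 0, f, hf => by
    have hf : f = 0 := hf
    subst hf; exact h0
  | n + 1, f, hf => fun k => by
    rw [hE, hEb]
    exact ⟨(hf k).1.map D h0 hE hEb, (hf k).2.map D h0 hE hEb⟩

lemma DegLT.Z {n : ℕ} {f : A} (hf : S.DegLT n f) (k : Fin 2) : S.DegLT n (S.Z k f) :=
  hf.map (S.Z k) (map_zero _) (fun _ _ => S.E_Z _ _ _) (fun _ _ => S.Eb_Z _ _ _)

lemma DegLT.Zb {n : ℕ} {f : A} (hf : S.DegLT n f) (k : Fin 2) : S.DegLT n (S.Zb k f) :=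
  hf.map (S.Zb k) (map_zero _) (fun _ _ => (S.Zb_E _ _ _).symm) (fun _ _ => (S.Zb_Eb _ _ _).symm)

lemma DegLT.neg {n : ℕ} {f : A} (hf : S.DegLT n f) : S.DegLT n (-f) :=
  hf.map (fun x => -x) neg_zero (fun _ _ => map_neg _ _) (fun _ _ => map_neg _ _)

lemma DegLT.y (k : Fin 2) : S.DegLT 2 (S.y k) := by
  intro i
  rw [S.E_y, S.Eb_y]
  refine ⟨?_, DegLT.zero 1⟩
  split_ifs
  · intro j
    simpa using DegLT.zero (S := S) 0
  · exact DegLT.zero 1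

lemma DegLT.iterate (v w : Fin 2 → ℂ) : ∀ {n} {f : A}, S.DegLT n f →
    (∑ k, (v k • S.E k + w k • S.Eb k) : Derivation ℂ A A)^[n] f = 0
  | 0, f, hf => hf
  | n + 1, f, hf => by
    have hs : ∀ {n} {f : A} (c : ℂ), S.DegLT n f → S.DegLT n (c • f) := fun c hf =>
      hf.map (fun x => c • x) (smul_zero _) (fun _ _ => Derivation.map_smul _ _ _)
        (fun _ _ => Derivation.map_smul _ _ _)
    rw [Function.iterate_succ_apply]
    refine DegLT.iterate v w ?_
    simp only [Fin.sum_univ_two, Derivation.add_apply, Derivation.smul_apply]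
    exact ((hs _ (hf 0).1).add (hs _ (hf 0).2)).add ((hs _ (hf 1).1).add (hs _ (hf 1).2))

variable (S)

section Quadratic

variable (hq : ∀ k l, S.E k (S.E l S.L) = 0)
include hq

/-- A vanishing (2,0) Hessian makes g independent of η, and Hermitian symmetry makes it independent
of η̄. -/
lemma degLT_g (i j : Fin 2) : S.DegLT 1 (S.g i j) := by
  have h : ∀ i j k, S.E k (S.g i j) = 0 := by
    intro i j k
    rw [g, ← S.Eb_E, hq, map_zero]
  intro k
  refine ⟨h i j k, ?_⟩
  rw [← S.conj_g, ← S.conj_E, h, map_zero]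
  rfl

lemma degLT_h (i j : Fin 2) : S.DegLT 1 (S.h i j) := by
  have key : ∀ D : Derivation ℂ A A, (∀ i j, D (S.g i j) = 0) → ∀ i j, D (S.h i j) = 0 := by
    intro D hD i j
    have e : ∀ l, S.g l 0 * D (S.h 0 j) + S.g l 1 * D (S.h 1 j) = 0 := by
      intro l
      have := congrArg D (S.g_h_two l j)
      simp only [map_add, Derivation.leibniz, smul_eq_mul, hD] at this
      split_ifs at this <;> simp at this <;> exact this
    have h0 := S.h_g_two i 0
    have h1 := S.h_g_two i 1
    fin_cases i <;> simp at h0 h1 ⊢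
    · linear_combination S.h 0 0 * e 0 + S.h 0 1 * e 1 - D (S.h 0 j) * h0 - D (S.h 1 j) * h1
    · linear_combination S.h 1 0 * e 0 + S.h 1 1 * e 1 - D (S.h 0 j) * h0 - D (S.h 1 j) * h1
  intro k
  exact ⟨key (S.E k) (fun i j => (S.degLT_g hq i j k).1) i j,
    key (S.Eb k) (fun i j => (S.degLT_g hq i j k).2) i j⟩

lemma degLT_Eb_L (i : Fin 2) : S.DegLT 2 (S.Eb i S.L) := by
  rw [S.Eb_L]
  exact ((S.degLT_g hq _ _).mul (DegLT.y _)).add ((S.degLT_g hq _ _).mul (DegLT.y _))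

lemma degLT_L : S.DegLT 3 S.L := by
  rw [← S.euler_conj]
  exact ((DegLT.y _).conj.mul (S.degLT_Eb_L hq _)).add ((DegLT.y _).conj.mul (S.degLT_Eb_L hq _))

lemma degLT_N0 (j : Fin 2) : S.DegLT 3 (S.N0 j) := by
  have hN : ∀ k, S.DegLT 2 (S.N j k) := by
    intro k
    rw [S.N_eq]
    exact ((S.degLT_h hq _ _).mul ((S.degLT_Eb_L hq _).Z _)).add
      ((S.degLT_h hq _ _).mul ((S.degLT_Eb_L hq _).Z _))
  rw [N0_two]
  exact ((hN _).mul (DegLT.y _)).add ((hN _).mul (DegLT.y _))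

lemma degLT_L_sq : S.DegLT 5 (S.L ^ 2) := by
  rw [pow_two]; exact (S.degLT_L hq).mul (S.degLT_L hq)

/-- N^i_0 is quadratic here, so each term of `δ0_Φ` has degree at most four. K alone is only a
quotient of polynomials, hence the factor L². -/
lemma degLT_K_L : S.DegLT 5 (S.K * S.L ^ 2) := by
  rw [S.K_L, S.δ0_Φ]
  have h1 : ∀ h k, S.DegLT 5 (S.yb h * S.y k * S.Zb h (S.Z k S.L)) := fun h k =>
    ((DegLT.y h).conj.mul (DegLT.y k)).mul (((S.degLT_L hq).Z k).Zb h)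
  have h2 : ∀ i j, S.DegLT 5 (S.g i j * S.N0 i * S.conj (S.N0 j)) := fun i j =>
    ((S.degLT_g hq i j).mul (S.degLT_N0 hq i)).mul (S.degLT_N0 hq j).conj
  rw [sub_eq_add_neg]
  exact (((((h1 _ _).add (h1 _ _)).add (h1 _ _)).add (h1 _ _)).add
    ((((h2 _ _).add (h2 _ _)).add (h2 _ _)).add (h2 _ _)).neg).neg

end Quadratic

end FinslerAlg
end CFinsler
end

noncomputable section

namespace CFinsler

/-! ### Wirtinger operators on smooth functions -/

section Wirt

lemma fderiv_eq_wirt_add_wirtBar (u : C2 × C2) (f : C2 × C2 → ℂ) (p : C2 × C2) :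
    fderiv ℝ f p u = wirt u f p + wirtBar u f p := by
  simp only [wirt, wirtBar]; ring

lemma wirt_add (u v : C2 × C2) (f : C2 × C2 → ℂ) (p : C2 × C2) :
    wirt (u + v) f p = wirt u f p + wirt v f p := by
  simp only [wirt, smul_add, map_add]; ring

lemma wirtBar_add (u v : C2 × C2) (f : C2 × C2 → ℂ) (p : C2 × C2) :
    wirtBar (u + v) f p = wirtBar u f p + wirtBar v f p := by
  simp only [wirtBar, smul_add, map_add]; ring

lemma fderiv_complex_smul (c : ℂ) (u : C2 × C2) (f : C2 × C2 → ℂ) (p : C2 × C2) :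
    fderiv ℝ f p (c • u) = c.re * fderiv ℝ f p u + c.im * fderiv ℝ f p (Complex.I • u) := by
  have : c • u = c.re • u + c.im • (Complex.I • u) := by
    conv_lhs => rw [← Complex.re_add_im c]
    rw [add_smul, mul_smul, Complex.coe_smul, Complex.coe_smul]
  rw [this, map_add, map_smul, map_smul, Complex.real_smul, Complex.real_smul]

lemma wirt_smul (c : ℂ) (u : C2 × C2) (f : C2 × C2 → ℂ) (p : C2 × C2) :
    wirt (c • u) f p = c * wirt u f p := by
  simp only [wirt, smul_smul, fderiv_complex_smul c, fderiv_complex_smul (Complex.I * c)]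
  simp only [Complex.mul_re, Complex.mul_im, Complex.I_re, Complex.I_im]
  push_cast
  linear_combination (1 / 2) * (fderiv ℝ f p u - Complex.I * fderiv ℝ f p (Complex.I • u)) *
    Complex.re_add_im c + (1 / 2) * fderiv ℝ f p (Complex.I • u) * c.im * Complex.I_sq

lemma wirtBar_smul (c : ℂ) (u : C2 × C2) (f : C2 × C2 → ℂ) (p : C2 × C2) :
    wirtBar (c • u) f p = star c * wirtBar u f p := by
  have h : star c = c.re - c.im * Complex.I := by
    apply Complex.ext <;> simp
  simp only [wirtBar, smul_smul, fderiv_complex_smul c, fderiv_complex_smul (Complex.I * c), h]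
  simp only [Complex.mul_re, Complex.mul_im, Complex.I_re, Complex.I_im]
  push_cast
  linear_combination (1 / 2) * fderiv ℝ f p (Complex.I • u) * c.im * Complex.I_sq

lemma decomp (u : C2 × C2) : u = (u.1 0 • (Pi.single 0 1, 0) + u.1 1 • (Pi.single 1 1, 0)) +
    (u.2 0 • (0, Pi.single 0 1) + u.2 1 • (0, Pi.single 1 1)) := by
  ext k <;> fin_cases k <;> simp

lemma wirt_eq (u : C2 × C2) (f : C2 × C2 → ℂ) (p : C2 × C2) : wirt u f p =
    (u.1 0 * dz 0 f p + u.1 1 * dz 1 f p) + (u.2 0 * dEta 0 f p + u.2 1 * dEta 1 f p) := by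
  conv_lhs => rw [decomp u]
  simp only [wirt_add, wirt_smul]; rfl

lemma wirtBar_eq (u : C2 × C2) (f : C2 × C2 → ℂ) (p : C2 × C2) : wirtBar u f p =
    (star (u.1 0) * dzBar 0 f p + star (u.1 1) * dzBar 1 f p) +
      (star (u.2 0) * dEtaBar 0 f p + star (u.2 1) * dEtaBar 1 f p) := by
  conv_lhs => rw [decomp u]
  simp only [wirtBar_add, wirtBar_smul]; rfl

variable {Ω : Set (C2 × C2)} {f g : C2 × C2 → ℂ} {p : C2 × C2}

/-- The operator `f ↦ a ∂_u f + b ∂_w f`. -/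
def firstOrder (a b : ℂ) (u w : C2 × C2) (f : C2 × C2 → ℂ) (p : C2 × C2) : ℂ :=
  a * fderiv ℝ f p u + b * fderiv ℝ f p w

lemma wirt_eq_firstOrder (u : C2 × C2) :
    wirt u = firstOrder (1 / 2) (-(1 / 2) * Complex.I) u (Complex.I • u) := by
  funext f p; simp only [wirt, firstOrder]; ring

lemma wirtBar_eq_firstOrder (u : C2 × C2) :
    wirtBar u = firstOrder (1 / 2) ((1 / 2) * Complex.I) u (Complex.I • u) := by
  funext f p; simp only [wirtBar, firstOrder]; ring

variable (a b : ℂ) (u w : C2 × C2)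

lemma contDiffOn_fderiv_apply (hΩ : IsOpen Ω) (hf : ContDiffOn ℝ ∞ f Ω) :
    ContDiffOn ℝ ∞ (fun p => fderiv ℝ f p u) Ω :=
  (hf.fderiv_of_isOpen hΩ (by simp)).clm_apply contDiffOn_const

lemma contDiffOn_firstOrder (hΩ : IsOpen Ω) (hf : ContDiffOn ℝ ∞ f Ω) :
    ContDiffOn ℝ ∞ (firstOrder a b u w f) Ω :=
  (contDiffOn_const.mul (contDiffOn_fderiv_apply u hΩ hf)).add
    (contDiffOn_const.mul (contDiffOn_fderiv_apply w hΩ hf))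

lemma differentiableAt_of_smoothOn (hΩ : IsOpen Ω) (hf : ContDiffOn ℝ ∞ f Ω) (hp : p ∈ Ω) :
    DifferentiableAt ℝ f p :=
  (hf.contDiffAt (hΩ.mem_nhds hp)).differentiableAt (by simp)

lemma firstOrder_congr (hΩ : IsOpen Ω) (h : Set.EqOn f g Ω) (hp : p ∈ Ω) :
    firstOrder a b u w f p = firstOrder a b u w g p := by
  have : f =ᶠ[nhds p] g := h.eventuallyEq_of_mem (hΩ.mem_nhds hp)
  simp only [firstOrder, this.fderiv_eq]

lemma fderiv_firstOrder (hΩ : IsOpen Ω) (hf : ContDiffOn ℝ ∞ f Ω) (hp : p ∈ Ω) (v : C2 × C2) :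
    fderiv ℝ (firstOrder a b u w f) p v =
      a * fderiv ℝ (fderiv ℝ f) p v u + b * fderiv ℝ (fderiv ℝ f) p v w := by
  have hd : DifferentiableAt ℝ (fderiv ℝ f) p :=
    ((hf.fderiv_of_isOpen hΩ (m := ∞) (by simp)).contDiffAt (hΩ.mem_nhds hp)).differentiableAt
      (by simp)
  have h1 : ∀ u, HasFDerivAt (fun q => fderiv ℝ f q u) ((fderiv ℝ (fderiv ℝ f) p).flip u) p := by
    intro u
    have := hd.hasFDerivAt.clm_apply (hasFDerivAt_const u p)
    simpa using this
  have h2 := ((h1 u).const_mul a).add ((h1 w).const_mul b)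
  have h3 : HasFDerivAt (firstOrder a b u w f) _ p := h2
  rw [h3.fderiv]
  simp

lemma firstOrder_comm (hΩ : IsOpen Ω) (hf : ContDiffOn ℝ ∞ f Ω) (hp : p ∈ Ω)
    (a' b' : ℂ) (u' w' : C2 × C2) :
    firstOrder a b u w (firstOrder a' b' u' w' f) p =
      firstOrder a' b' u' w' (firstOrder a b u w f) p := by
  have hs : IsSymmSndFDerivAt ℝ f p :=
    (hf.contDiffAt (hΩ.mem_nhds hp)).isSymmSndFDerivAt (by
      rw [minSmoothness_of_isRCLikeNormedField]; exact WithTop.coe_le_coe.2 (OrderTop.le_top (2 : ℕ∞)))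
  have e1 := fderiv_firstOrder a' b' u' w' hΩ hf hp
  have e2 := fderiv_firstOrder a b u w hΩ hf hp
  rw [firstOrder, firstOrder, e1, e1, e2, e2, hs u u', hs u w', hs w u', hs w w']
  ring

lemma firstOrder_mul (hf : DifferentiableAt ℝ f p) (hg : DifferentiableAt ℝ g p) :
    firstOrder a b u w (fun q => f q * g q) p =
      f p * firstOrder a b u w g p + g p * firstOrder a b u w f p := by
  have h := (hf.hasFDerivAt.mul hg.hasFDerivAt).fderiv
  have h' : fderiv ℝ (fun q => f q * g q) p = f p • fderiv ℝ g p + g p • fderiv ℝ f p := h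
  simp only [firstOrder, h']
  simp only [_root_.add_apply, _root_.smul_apply, smul_eq_mul]
  ring

lemma firstOrder_add (hf : DifferentiableAt ℝ f p) (hg : DifferentiableAt ℝ g p) :
    firstOrder a b u w (fun q => f q + g q) p =
      firstOrder a b u w f p + firstOrder a b u w g p := by
  simp only [firstOrder, fderiv_fun_add hf hg, _root_.add_apply]
  ring

lemma firstOrder_const_mul (c : ℂ) (hf : DifferentiableAt ℝ f p) :
    firstOrder a b u w (fun q => c * f q) p = c * firstOrder a b u w f p := by
  simp only [firstOrder, fderiv_const_mul hf c, _root_.smul_apply, smul_eq_mul]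
  ring

lemma fderiv_star_apply (hf : DifferentiableAt ℝ f p) :
    fderiv ℝ (fun q => star (f q)) p u = star (fderiv ℝ f p u) := by
  have h := (Complex.conjCLE.toContinuousLinearMap.hasFDerivAt (x := f p)).comp p hf.hasFDerivAt
  have h' : HasFDerivAt (fun q => star (f q)) _ p := h
  rw [h'.fderiv]
  rfl

lemma star_wirt (hf : DifferentiableAt ℝ f p) :
    star (wirt u f p) = wirtBar u (fun q => star (f q)) p := by
  simp only [wirt, wirtBar, fderiv_star_apply _ hf, star_mul', star_sub]
  simp

end Wirt

/-! ### The algebra of smooth functions on an open set -/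

/-- The algebra of functions on `Ω` that are smooth in the real sense. -/
def SmoothAlg (Ω : Set (C2 × C2)) : Subalgebra ℂ (Ω → ℂ) where
  carrier := {f | ∃ F : C2 × C2 → ℂ, ContDiffOn ℝ ∞ F Ω ∧ ∀ p : Ω, f p = F p}
  mul_mem' := by
    rintro f g ⟨F, hF, hf⟩ ⟨G, hG, hg⟩
    exact ⟨fun p => F p * G p, hF.mul hG, fun p => by simp [hf, hg]⟩
  add_mem' := by
    rintro f g ⟨F, hF, hf⟩ ⟨G, hG, hg⟩
    exact ⟨fun p => F p + G p, hF.add hG, fun p => by simp [hf, hg]⟩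
  algebraMap_mem' := fun c => ⟨fun _ => c, contDiffOn_const, fun _ => rfl⟩

namespace SmoothAlg

variable {Ω : Set (C2 × C2)}

/-- `f` is the restriction of `F` to `Ω`. -/
def Rep (f : SmoothAlg Ω) (F : C2 × C2 → ℂ) : Prop := ∀ p, ∀ hp : p ∈ Ω, f.1 ⟨p, hp⟩ = F p

/-- The restriction to `Ω` of a function that is smooth there. -/
def restrict (F : C2 × C2 → ℂ) (hF : ContDiffOn ℝ ∞ F Ω) : SmoothAlg Ω :=
  ⟨fun p => F p, F, hF, fun _ => rfl⟩

/-- A function on the whole space that restricts to `f`. -/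
def ext (f : SmoothAlg Ω) : C2 × C2 → ℂ := f.2.choose

lemma contDiffOn_ext (f : SmoothAlg Ω) : ContDiffOn ℝ ∞ (ext f) Ω := f.2.choose_spec.1

lemma rep_ext (f : SmoothAlg Ω) : Rep f (ext f) := fun p hp => f.2.choose_spec.2 ⟨p, hp⟩

lemma rep_restrict (F : C2 × C2 → ℂ) (hF : ContDiffOn ℝ ∞ F Ω) : Rep (restrict F hF) F := fun _ _ => rfl

lemma Rep.eqOn {f : SmoothAlg Ω} {F G : C2 × C2 → ℂ} (hF : Rep f F) (hG : Rep f G) :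
    Set.EqOn F G Ω := fun p hp => (hF p hp).symm.trans (hG p hp)

lemma Rep.contDiffOn {f : SmoothAlg Ω} {F : C2 × C2 → ℂ} (hF : Rep f F) : ContDiffOn ℝ ∞ F Ω :=
  (contDiffOn_ext f).congr (hF.eqOn (rep_ext f))

lemma Rep.congr {f : SmoothAlg Ω} {F G : C2 × C2 → ℂ} (hF : Rep f F) (h : Set.EqOn F G Ω) :
    Rep f G := fun p hp => (hF p hp).trans (h hp)

/-- Elements of the algebra live on Ω while `fderiv` acts on functions of the whole space.
Identities pass through representatives, whose values off the open set Ω do not affect derivatives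
on it. -/
lemma ext_of_rep {f g : SmoothAlg Ω} {F : C2 × C2 → ℂ} (hf : Rep f F) (hg : Rep g F) : f = g := by
  apply Subtype.ext
  funext p
  exact (hf p p.2).trans (hg p p.2).symm

lemma Rep.add {f g : SmoothAlg Ω} {F G : C2 × C2 → ℂ} (hF : Rep f F) (hG : Rep g G) :
    Rep (f + g) (fun p => F p + G p) := fun p hp => by
  beta_reduce
  rw [← hF p hp, ← hG p hp]; rfl

lemma Rep.sub {f g : SmoothAlg Ω} {F G : C2 × C2 → ℂ} (hF : Rep f F) (hG : Rep g G) :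
    Rep (f - g) (fun p => F p - G p) := fun p hp => by
  beta_reduce
  rw [← hF p hp, ← hG p hp]; rfl

lemma Rep.neg {f : SmoothAlg Ω} {F : C2 × C2 → ℂ} (hF : Rep f F) :
    Rep (-f) (fun p => - F p) := fun p hp => by
  beta_reduce
  rw [← hF p hp]; rfl

lemma Rep.mul {f g : SmoothAlg Ω} {F G : C2 × C2 → ℂ} (hF : Rep f F) (hG : Rep g G) :
    Rep (f * g) (fun p => F p * G p) := fun p hp => by
  beta_reduce
  rw [← hF p hp, ← hG p hp]; rfl

lemma Rep.smul {f : SmoothAlg Ω} {F : C2 × C2 → ℂ} (c : ℂ) (hF : Rep f F) :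
    Rep (c • f) (fun p => c * F p) := fun p hp => by
  beta_reduce
  rw [← hF p hp]; rfl

lemma rep_const (c : ℂ) : Rep (algebraMap ℂ (SmoothAlg Ω) c) (fun _ => c) := fun _ _ => rfl

lemma rep_zero : Rep (0 : SmoothAlg Ω) (fun _ => 0) := fun _ _ => rfl

lemma rep_one : Rep (1 : SmoothAlg Ω) (fun _ => 1) := fun _ _ => rfl

lemma Rep.sum {ι : Type*} {s : Finset ι} {f : ι → SmoothAlg Ω} {F : ι → C2 × C2 → ℂ}
    (h : ∀ i, Rep (f i) (F i)) : Rep (∑ i ∈ s, f i) (fun p => ∑ i ∈ s, F i p) := by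
  classical
  induction s using Finset.induction_on with
  | empty => simpa using rep_zero
  | insert i s hi ih =>
    simp only [Finset.sum_insert hi]
    exact (h i).add ih

/-- Complex conjugation. -/
def conj : SmoothAlg Ω →+* SmoothAlg Ω where
  toFun f := restrict (fun p => star (ext f p))
    (Complex.conjCLE.contDiff.comp_contDiffOn (contDiffOn_ext f))
  map_one' := ext_of_rep (rep_restrict _ _) (rep_one.congr fun p hp => by
    rw [← rep_ext 1 p hp]; exact (star_one ℂ).symm)
  map_zero' := ext_of_rep (rep_restrict _ _) (rep_zero.congr fun p hp => by
    rw [← rep_ext 0 p hp]; exact (star_zero ℂ).symm)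
  map_add' f g := ext_of_rep (rep_restrict _ _) (((rep_restrict _ _).add (rep_restrict _ _)).congr fun p hp => by
    beta_reduce
    rw [← rep_ext f p hp, ← rep_ext g p hp, ← rep_ext (f + g) p hp]; exact (star_add _ _).symm)
  map_mul' f g := ext_of_rep (rep_restrict _ _) (((rep_restrict _ _).mul (rep_restrict _ _)).congr fun p hp => by
    beta_reduce
    rw [← rep_ext f p hp, ← rep_ext g p hp, ← rep_ext (f * g) p hp]; exact (star_mul' _ _).symm)

lemma Rep.conj {f : SmoothAlg Ω} {F : C2 × C2 → ℂ} (hF : Rep f F) :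
    Rep (conj f) (fun p => star (F p)) := fun p hp => by
  change star (ext f p) = star (F p)
  rw [hF.eqOn (rep_ext f) hp]

variable (hΩ : IsOpen Ω)
include hΩ

lemma Rep.differentiableAt {f : SmoothAlg Ω} {F : C2 × C2 → ℂ} (hF : Rep f F) {p : C2 × C2}
    (hp : p ∈ Ω) : DifferentiableAt ℝ F p := differentiableAt_of_smoothOn hΩ hF.contDiffOn hp

/-- First order operators as derivations of the algebra of smooth functions. -/
def der (a b : ℂ) (u w : C2 × C2) : Derivation ℂ (SmoothAlg Ω) (SmoothAlg Ω) :=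
  Derivation.mk'
    { toFun := fun f => restrict (firstOrder a b u w (ext f))
        (contDiffOn_firstOrder a b u w hΩ (contDiffOn_ext f))
      map_add' := fun f g => ext_of_rep (rep_restrict _ _)
        (((rep_restrict _ _).add (rep_restrict _ _)).congr fun p hp => by
          beta_reduce
          rw [← firstOrder_add _ _ _ _ ((rep_ext f).differentiableAt hΩ hp)
            ((rep_ext g).differentiableAt hΩ hp)]
          exact firstOrder_congr _ _ _ _ hΩ (((rep_ext f).add (rep_ext g)).eqOn (rep_ext _)) hp)
      map_smul' := fun c f => ext_of_rep (rep_restrict _ _)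
        (((rep_restrict _ _).smul c).congr fun p hp => by
          beta_reduce
          rw [← firstOrder_const_mul _ _ _ _ _ ((rep_ext f).differentiableAt hΩ hp)]
          exact firstOrder_congr _ _ _ _ hΩ (((rep_ext f).smul c).eqOn (rep_ext _)) hp) }
    (fun f g => ext_of_rep
      (rep_restrict _ (contDiffOn_firstOrder a b u w hΩ (contDiffOn_ext (f * g))))
      ((((rep_ext f).mul (rep_restrict _ (contDiffOn_firstOrder a b u w hΩ (contDiffOn_ext g)))).add
        ((rep_ext g).mul (rep_restrict _ (contDiffOn_firstOrder a b u w hΩ (contDiffOn_ext f))))).congr fun p hp => by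
          beta_reduce
          rw [← firstOrder_mul _ _ _ _ ((rep_ext f).differentiableAt hΩ hp)
            ((rep_ext g).differentiableAt hΩ hp)]
          exact firstOrder_congr _ _ _ _ hΩ (((rep_ext f).mul (rep_ext g)).eqOn (rep_ext _)) hp))

lemma Rep.der {f : SmoothAlg Ω} {F : C2 × C2 → ℂ} (hF : Rep f F) (a b : ℂ) (u w : C2 × C2) :
    Rep (der hΩ a b u w f) (firstOrder a b u w F) := fun p hp => by
  change firstOrder a b u w (ext f) p = firstOrder a b u w F p
  exact firstOrder_congr a b u w hΩ ((rep_ext f).eqOn hF) hp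

lemma der_comm (a b : ℂ) (u w : C2 × C2) (a' b' : ℂ) (u' w' : C2 × C2) (f : SmoothAlg Ω) :
    SmoothAlg.der hΩ a b u w (SmoothAlg.der hΩ a' b' u' w' f) =
      SmoothAlg.der hΩ a' b' u' w' (SmoothAlg.der hΩ a b u w f) :=
  ext_of_rep (((rep_ext f).der hΩ a' b' u' w').der hΩ a b u w)
    ((((rep_ext f).der hΩ a b u w).der hΩ a' b' u' w').congr fun _ hp =>
      firstOrder_comm _ _ _ _ hΩ (contDiffOn_ext f) hp _ _ _ _)

/-- Wirtinger derivation of type `(1,0)`. -/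
def wirtDer (u : C2 × C2) : Derivation ℂ (SmoothAlg Ω) (SmoothAlg Ω) :=
  SmoothAlg.der hΩ (1 / 2) (-(1 / 2) * Complex.I) u (Complex.I • u)

/-- Wirtinger derivation of type `(0,1)`. -/
def wirtBarDer (u : C2 × C2) : Derivation ℂ (SmoothAlg Ω) (SmoothAlg Ω) :=
  SmoothAlg.der hΩ (1 / 2) ((1 / 2) * Complex.I) u (Complex.I • u)

lemma Rep.wirt {f : SmoothAlg Ω} {F : C2 × C2 → ℂ} (hF : Rep f F) (u : C2 × C2) :
    Rep (wirtDer hΩ u f) (wirt u F) := by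
  rw [wirt_eq_firstOrder]; exact hF.der hΩ _ _ _ _

lemma Rep.wirtBar {f : SmoothAlg Ω} {F : C2 × C2 → ℂ} (hF : Rep f F) (u : C2 × C2) :
    Rep (wirtBarDer hΩ u f) (wirtBar u F) := by
  rw [wirtBar_eq_firstOrder]; exact hF.der hΩ _ _ _ _

lemma conj_wirtDer (u : C2 × C2) (f : SmoothAlg Ω) :
    SmoothAlg.conj (wirtDer hΩ u f) = wirtBarDer hΩ u (SmoothAlg.conj f) :=
  ext_of_rep ((rep_ext f).wirt hΩ u).conj (((rep_ext f).conj.wirtBar hΩ u).congr fun _ hp =>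
    (star_wirt _ ((rep_ext f).differentiableAt hΩ hp)).symm)

end SmoothAlg

lemma fderiv_snd_apply (p u : C2 × C2) (k : Fin 2) :
    fderiv ℝ (fun q : C2 × C2 => q.2 k) p u = u.2 k := by
  have h : HasFDerivAt (fun q : C2 × C2 => q.2 k)
      ((ContinuousLinearMap.proj (R := ℝ) (φ := fun _ : Fin 2 => ℂ) k).comp
        (ContinuousLinearMap.snd ℝ C2 C2)) p :=
    ((ContinuousLinearMap.proj (R := ℝ) (φ := fun _ : Fin 2 => ℂ) k).comp
      (ContinuousLinearMap.snd ℝ C2 C2)).hasFDerivAt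
  rw [h.fderiv]; rfl

lemma wirt_snd (p u : C2 × C2) (k : Fin 2) : wirt u (fun q : C2 × C2 => q.2 k) p = u.2 k := by
  simp only [wirt, fderiv_snd_apply, Prod.smul_snd, Pi.smul_apply, smul_eq_mul]
  linear_combination (-(1 / 2) * u.2 k) * Complex.I_sq

lemma wirtBar_snd (p u : C2 × C2) (k : Fin 2) :
    wirtBar u (fun q : C2 × C2 => q.2 k) p = 0 := by
  simp only [wirtBar, fderiv_snd_apply, Prod.smul_snd, Pi.smul_apply, smul_eq_mul]
  linear_combination ((1 / 2) * u.2 k) * Complex.I_sq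

end CFinsler
end

/-! ### A complex Finsler function on an open set as an instance of the differential algebra. -/

noncomputable section

namespace CFinsler

/-- `L` is the square of a complex Finsler function on the open set `Ω`. -/
structure FinslerOn (L : C2 × C2 → ℝ) (Ω : Set (C2 × C2)) : Prop where
  isOpen : IsOpen Ω
  smooth : ContDiffOn ℝ ∞ L Ω
  pos : ∀ p ∈ Ω, 0 < L p
  euler : ∀ p ∈ Ω, ∑ k, p.2 k * dEta k (fun q => (L q : ℂ)) p = (L p : ℂ)
  posDef : ∀ p ∈ Ω, (gMat L p).PosDef

namespace FinslerOn

open SmoothAlg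

variable {L : C2 × C2 → ℝ} {Ω : Set (C2 × C2)} (H : FinslerOn L Ω)

include H in
lemma mono {Ω' : Set (C2 × C2)} (h : Ω' ⊆ Ω) (ho : IsOpen Ω') : FinslerOn L Ω' :=
  ⟨ho, H.smooth.mono h, fun p hp => H.pos p (h hp), fun p hp => H.euler p (h hp),
    fun p hp => H.posDef p (h hp)⟩

include H in
lemma contDiffOn_ofReal : ContDiffOn ℝ ∞ (fun q => (L q : ℂ)) Ω :=
  Complex.ofRealCLM.contDiff.comp_contDiffOn H.smooth

include H in
lemma contDiffOn_g (i j : Fin 2) : ContDiffOn ℝ ∞ (g L i j) Ω :=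
  (((rep_restrict _ H.contDiffOn_ofReal).wirt H.isOpen (0, Pi.single i 1)).wirtBar H.isOpen
    (0, Pi.single j 1)).contDiffOn

include H in
lemma det_ne_zero {p : C2 × C2} (hp : p ∈ Ω) : (gMat L p).det ≠ 0 :=
  (H.posDef p hp).det_pos.ne'

include H in
lemma contDiffOn_gInv (m k : Fin 2) : ContDiffOn ℝ ∞ (gInv L m k) Ω := by
  have hdet : ContDiffOn ℝ ∞ (fun p => (gMat L p).det) Ω := by
    simp only [Matrix.det_fin_two]
    exact ((H.contDiffOn_g 0 0).mul (H.contDiffOn_g 1 1)).sub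
      ((H.contDiffOn_g 0 1).mul (H.contDiffOn_g 1 0))
  have hadj : ContDiffOn ℝ ∞ (fun p => (gMat L p).adjugate m k) Ω := by
    simp only [Matrix.adjugate_fin_two]
    fin_cases m <;> fin_cases k
    · exact H.contDiffOn_g 1 1
    · exact (H.contDiffOn_g 0 1).neg
    · exact (H.contDiffOn_g 1 0).neg
    · exact H.contDiffOn_g 0 0
  have : gInv L m k = fun p => ((gMat L p).det)⁻¹ * (gMat L p).adjugate m k := by
    funext p
    simp [gInv, Matrix.inv_def]
  rw [this]
  exact (hdet.inv fun p hp => H.det_ne_zero hp).mul hadj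

include H in
lemma contDiffOn_inv_Fc : ContDiffOn ℝ ∞ (fun p => (Fc L p)⁻¹) Ω := by
  have h1 : ContDiffOn ℝ ∞ (fun p => Real.sqrt (L p)) Ω :=
    H.smooth.sqrt fun p hp => (H.pos p hp).ne'
  have h2 : ContDiffOn ℝ ∞ (Fc L) Ω := Complex.ofRealCLM.contDiff.comp_contDiffOn h1
  refine h2.inv fun p hp => ?_
  simpa [Fc] using (Real.sqrt_pos.2 (H.pos p hp)).ne'

include H in
lemma Fc_mul_self {p : C2 × C2} (hp : p ∈ Ω) : Fc L p * Fc L p = (L p : ℂ) := by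
  rw [Fc, ← Complex.ofReal_mul, Real.mul_self_sqrt (H.pos p hp).le]

include H in
lemma ofReal_ne_zero {p : C2 × C2} (hp : p ∈ Ω) : (L p : ℂ) ≠ 0 :=
  Complex.ofReal_ne_zero.2 (H.pos p hp).ne'

lemma contDiff_snd_apply (k : Fin 2) : ContDiff ℝ ∞ (fun q : C2 × C2 => q.2 k) :=
  (contDiff_apply ℝ ℂ k).comp contDiff_snd

lemma repSnd (Ω : Set (C2 × C2)) (k : Fin 2) :
    Rep (restrict (Ω := Ω) (fun q => q.2 k) (contDiff_snd_apply k).contDiffOn) (fun q => q.2 k) :=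
  rep_restrict _ _

/-- The differential algebra of a complex Finsler function. -/
def alg : FinslerAlg (SmoothAlg Ω) where
  conj := SmoothAlg.conj
  conj_conj f := ext_of_rep (rep_ext f).conj.conj ((rep_ext f).congr fun p _ => by simp)
  Z k := wirtDer H.isOpen (Pi.single k 1, 0)
  Zb k := wirtBarDer H.isOpen (Pi.single k 1, 0)
  E k := wirtDer H.isOpen (0, Pi.single k 1)
  Eb k := wirtBarDer H.isOpen (0, Pi.single k 1)
  conj_Z _ f := conj_wirtDer _ _ f
  conj_E _ f := conj_wirtDer _ _ f
  Z_Z _ _ _ := der_comm _ _ _ _ _ _ _ _ _ _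
  Zb_Z _ _ _ := der_comm _ _ _ _ _ _ _ _ _ _
  E_Z _ _ _ := der_comm _ _ _ _ _ _ _ _ _ _
  Eb_Z _ _ _ := der_comm _ _ _ _ _ _ _ _ _ _
  E_E _ _ _ := der_comm _ _ _ _ _ _ _ _ _ _
  Eb_E _ _ _ := der_comm _ _ _ _ _ _ _ _ _ _
  y k := restrict (fun q => q.2 k) (contDiff_snd_apply k).contDiffOn
  Z_y k l := ext_of_rep ((repSnd Ω l).wirt _ _) (rep_zero.congr fun p _ => by simp [wirt_snd])
  Zb_y k l := ext_of_rep ((repSnd Ω l).wirtBar _ _)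
    (rep_zero.congr fun p _ => by simp [wirtBar_snd])
  E_y k l := by
    split_ifs with h
    · exact ext_of_rep ((repSnd Ω l).wirt _ _)
        (rep_one.congr fun p _ => by simp [wirt_snd, h])
    · exact ext_of_rep ((repSnd Ω l).wirt _ _)
        (rep_zero.congr fun p _ => by simp [wirt_snd, Ne.symm h])
  Eb_y k l := ext_of_rep ((repSnd Ω l).wirtBar _ _)
    (rep_zero.congr fun p _ => by simp [wirtBar_snd])
  L := restrict _ H.contDiffOn_ofReal
  conj_L := ext_of_rep (rep_restrict _ H.contDiffOn_ofReal).conj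
    ((rep_restrict _ H.contDiffOn_ofReal).congr fun p _ => (Complex.conj_ofReal _).symm)
  euler := ext_of_rep
    (Rep.sum fun k => (repSnd Ω k).mul ((rep_restrict _ H.contDiffOn_ofReal).wirt H.isOpen _))
    ((rep_restrict _ H.contDiffOn_ofReal).congr fun p hp => (H.euler p hp).symm)
  Fi := restrict _ H.contDiffOn_inv_Fc
  Fi_sq := ext_of_rep (((rep_restrict _ H.contDiffOn_inv_Fc).mul (rep_restrict _ H.contDiffOn_inv_Fc)).mul
      (rep_restrict _ H.contDiffOn_ofReal)) (rep_one.congr fun p hp => by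
        have := H.ofReal_ne_zero hp
        beta_reduce
        rw [← mul_inv, H.Fc_mul_self hp, inv_mul_cancel₀ this])
  h m k := restrict _ (H.contDiffOn_gInv m k)
  g_h l k := by
    have e := Rep.sum (s := Finset.univ) fun m =>
      (((rep_restrict _ H.contDiffOn_ofReal).wirt H.isOpen (0, Pi.single l 1)).wirtBar H.isOpen
        (0, Pi.single m 1)).mul (rep_restrict _ (H.contDiffOn_gInv m k))
    have key : ∀ p ∈ Ω, ∑ m, gMat L p l m * (gMat L p)⁻¹ m k = (1 : Matrix _ _ ℂ) l k := by
      intro p hp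
      rw [← Matrix.mul_apply, Matrix.mul_nonsing_inv _ (IsUnit.mk0 _ (H.det_ne_zero hp))]
    split_ifs with h
    · refine ext_of_rep e (rep_one.congr fun p hp => ?_)
      have := key p hp
      rw [h, Matrix.one_apply_eq] at this
      rw [h]
      exact this.symm
    · refine ext_of_rep e (rep_zero.congr fun p hp => ?_)
      have := key p hp
      rw [Matrix.one_apply_ne h] at this
      exact this.symm
  h_g m l := by
    have e := Rep.sum (s := Finset.univ) fun k =>
      (rep_restrict _ (H.contDiffOn_gInv m k)).mul
      (((rep_restrict _ H.contDiffOn_ofReal).wirt H.isOpen (0, Pi.single k 1)).wirtBar H.isOpen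
        (0, Pi.single l 1))
    have key : ∀ p ∈ Ω, ∑ k, (gMat L p)⁻¹ m k * gMat L p k l = (1 : Matrix _ _ ℂ) m l := by
      intro p hp
      rw [← Matrix.mul_apply, Matrix.nonsing_inv_mul _ (IsUnit.mk0 _ (H.det_ne_zero hp))]
    split_ifs with h
    · refine ext_of_rep e (rep_one.congr fun p hp => ?_)
      have := key p hp
      rw [h, Matrix.one_apply_eq] at this
      rw [h]
      exact this.symm
    · refine ext_of_rep e (rep_zero.congr fun p hp => ?_)
      have := key p hp
      rw [Matrix.one_apply_ne h] at this
      exact this.symm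

lemma repL : Rep H.alg.L (fun q => (L q : ℂ)) := fun _ _ => rfl

lemma repy (k : Fin 2) : Rep (H.alg.y k) (fun q => q.2 k) := fun _ _ => rfl

lemma repyb (k : Fin 2) : Rep (H.alg.yb k) (fun q => star (q.2 k)) := (H.repy k).conj

lemma repFi : Rep H.alg.Fi (fun q => (Fc L q)⁻¹) := fun _ _ => rfl

lemma reph (m k : Fin 2) : Rep (H.alg.h m k) (gInv L m k) := fun _ _ => rfl

variable {f : SmoothAlg Ω} {F : C2 × C2 → ℂ}

lemma repZ (hF : Rep f F) (k : Fin 2) : Rep (H.alg.Z k f) (dz k F) := hF.wirt H.isOpen _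

lemma repZb (hF : Rep f F) (k : Fin 2) : Rep (H.alg.Zb k f) (dzBar k F) := hF.wirtBar H.isOpen _

lemma repE (hF : Rep f F) (k : Fin 2) : Rep (H.alg.E k f) (dEta k F) := hF.wirt H.isOpen _

lemma repEb (hF : Rep f F) (k : Fin 2) : Rep (H.alg.Eb k f) (dEtaBar k F) := hF.wirtBar H.isOpen _

lemma repg (i j : Fin 2) : Rep (H.alg.g i j) (g L i j) := H.repEb (H.repE H.repL i) j

lemma repN (k j : Fin 2) : Rep (H.alg.N k j) (N L k j) :=
  Rep.sum fun m => Rep.sum fun l => ((H.reph m k).mul (H.repZ (H.repg l m) j)).mul (H.repy l)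

lemma repδ (hF : Rep f F) (k : Fin 2) : Rep (H.alg.δ k f) (delta L k F) := by
  rw [FinslerAlg.δ_apply]
  refine ((H.repZ hF k).sub (((H.repN 0 k).mul (H.repE hF 0)).add
    ((H.repN 1 k).mul (H.repE hF 1)))).congr fun p _ => ?_
  simp [delta, Fin.sum_univ_two]

lemma repδb (hF : Rep f F) (k : Fin 2) : Rep (H.alg.δb k f) (deltaBar L k F) := by
  rw [FinslerAlg.δb_apply]
  refine ((H.repZb hF k).sub (((H.repN 0 k).conj.mul (H.repEb hF 0)).add
    ((H.repN 1 k).conj.mul (H.repEb hF 1)))).congr fun p _ => ?_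
  simp [deltaBar, Fin.sum_univ_two]

lemma rephC (i j k : Fin 2) : Rep (H.alg.hC i j k) (hCoeff L i j k) :=
  Rep.sum fun l => (H.reph l i).mul (H.repδ (H.repg j l) k)

lemma repvC (i j k : Fin 2) : Rep (H.alg.vC i j k) (vCoeff L i j k) :=
  Rep.sum fun l => (H.reph l i).mul (H.repE (H.repg j l) k)

lemma repcv (i j h k : Fin 2) : Rep (H.alg.cv i j h k) (curv L i j h k) :=
  (H.repδb (H.rephC i j k) h).neg.sub
    (Rep.sum fun l => (H.repδb (H.repN l k) h).mul (H.repvC i j l))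

lemma reprm (r j h k : Fin 2) : Rep (H.alg.rm r j h k) (riem L r j h k) :=
  Rep.sum fun l => (H.repg l r).mul (H.repcv l j h k)

lemma replUp (k : Fin 2) : Rep (H.alg.y k * H.alg.Fi) (lUp L k) :=
  ((H.repy k).mul H.repFi).congr fun p _ => by simp [lUp, div_eq_mul_inv]

lemma replDown (i : Fin 2) :
    Rep ((∑ l, H.alg.g i l * H.alg.yb l) * H.alg.Fi) (lDown L i) :=
  ((Rep.sum fun l => (H.repg i l).mul (H.repyb l)).mul H.repFi).congr fun p _ => by
    simp [lDown, div_eq_mul_inv]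

lemma repJ : Rep H.alg.J (termJ L) :=
  Rep.sum fun i => Rep.sum fun j => Rep.sum fun k =>
    (((H.replUp j).mul (H.replUp k)).mul (H.replDown i)).mul (H.rephC i j k)

lemma repK : Rep H.alg.K (invK L) := by
  rw [FinslerAlg.K_eq_J]
  exact ((Rep.sum (s := Finset.univ) fun h => (H.repyb h).mul (H.repδb H.repJ h)).neg.mul
    H.repFi).congr fun p _ => by simp [invK, div_eq_mul_inv]

lemma repN0 (i : Fin 2) : Rep (H.alg.N0 i) (fun p => ∑ k, N L i k p * p.2 k) :=
  Rep.sum fun k => (H.repN i k).mul (H.repy k)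

include H in
lemma contDiffOn_invK : ContDiffOn ℝ ∞ (invK L) Ω := H.repK.contDiffOn

include H in
lemma star_invK {p : C2 × C2} (hp : p ∈ Ω) : star (invK L p) = invK L p := by
  have h := H.repK.conj
  change Rep (H.alg.conj H.alg.K) _ at h
  rw [H.alg.conj_K] at h
  exact h.eqOn H.repK hp

include H in
lemma holSecCurv_eq {p : C2 × C2} (hp : p ∈ Ω) : holSecCurv L p = 2 * invK L p := by
  have hs : ∀ i, star (lUp L i p) = star (p.2 i) * (Fc L p)⁻¹ := by
    intro i
    simp [lUp, Fc, div_eq_mul_inv]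
  have h : Rep H.alg.K (fun p => ∑ r, ∑ j, ∑ h, ∑ k, (star (p.2 h) * (Fc L p)⁻¹) *
      (star (p.2 r) * (Fc L p)⁻¹) * lUp L j p * lUp L k p * riem L r j h k p) := by
    rw [← H.alg.K_eq_rm]
    exact Rep.sum fun r => Rep.sum fun j => Rep.sum fun h => Rep.sum fun k =>
      (((((H.repyb h).mul H.repFi).mul ((H.repyb r).mul H.repFi)).mul (H.replUp j)).mul
        (H.replUp k)).mul (H.reprm r j h k)
  have e := h.eqOn H.repK hp
  beta_reduce at e
  rw [← e, holSecCurv]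
  simp only [hs]

lemma weaklyKahler (h : ∀ p ∈ Ω, ∀ k : Fin 2,
    ∑ i, ∑ j, ∑ l, g L i l p * torsion L i j k p * p.2 j * star (p.2 l) = 0) :
    H.alg.WeaklyKahler := by
  refine H.alg.weaklyKahler_of_torsion fun k => ?_
  exact ext_of_rep (Rep.sum fun i => Rep.sum fun j => Rep.sum fun l =>
    (((H.repg i l).mul ((H.rephC i j k).sub (H.rephC i k j))).mul (H.repy j)).mul (H.repyb l))
    (rep_zero.congr fun p hp => (h p hp k).symm)

lemma curvatureFlat (hW : H.alg.WeaklyKahler)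
    (h : ∀ p ∈ Ω, ∀ k : Fin 2, riem0k00 L k p = riem000k L k p) : H.alg.CurvatureFlat := by
  refine H.alg.curvatureFlat_of_symmetric hW fun k => ?_
  exact ext_of_rep (Rep.sum fun r => Rep.sum fun h => Rep.sum fun m =>
    (((H.repyb r).mul (H.repyb h)).mul (H.repy m)).mul (H.reprm r k h m))
    ((Rep.sum fun r => Rep.sum fun j => Rep.sum fun h =>
    (((H.repyb r).mul (H.repy j)).mul (H.repyb h)).mul (H.reprm r j h k)).congr
      fun p hp => (h p hp k).symm)

/-- The vertical Hessian of type `(2,0)`. -/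
lemma repEE (j k : Fin 2) : Rep (H.alg.E j (H.alg.E k H.alg.L))
    (dEta j (dEta k fun q => (L q : ℂ))) := H.repE (H.repE H.repL k) j

include H in
lemma exists_hessian_ne_zero {p : C2 × C2} (hp : p ∈ Ω) (hA : termA L p ≠ 0) :
    ∃ j k, dEta j (dEta k fun q => (L q : ℂ)) p ≠ 0 := by
  by_contra! hc
  apply hA
  -- The vector m is frozen at p: constants lie in the algebra, and only the values at p are
  -- compared.
  have h := H.alg.termA_eq (fun j => algebraMap ℂ _ (mUp L p j))
  have e1 : Rep (∑ j, ∑ k, ∑ h, algebraMap ℂ (SmoothAlg Ω) (mUp L p j) *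
      algebraMap ℂ (SmoothAlg Ω) (mUp L p k) * ((∑ l, H.alg.g h l * H.alg.yb l) * H.alg.Fi) *
      H.alg.vC h k j) (fun q => ∑ j, ∑ k, ∑ h, mUp L p j * mUp L p k * lDown L h q *
        vCoeff L h k j q) :=
    Rep.sum fun j => Rep.sum fun k => Rep.sum fun h =>
      (((rep_const _).mul (rep_const _)).mul (H.replDown h)).mul (H.repvC h k j)
  have e2 := H.repFi.mul (Rep.sum (s := Finset.univ) fun j => Rep.sum (s := Finset.univ) fun k =>
    ((rep_const (Ω := Ω) (mUp L p j)).mul (rep_const (mUp L p k))).mul (H.repEE j k))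
  rw [h] at e1
  have e := e1.eqOn e2 hp
  beta_reduce at e
  rw [termA, e]
  simp [hc]

end FinslerOn

end CFinsler
end

/-! ### Vertical derivatives of K L² where the (2,0) Hessian is nonzero and where it vanishes. -/

noncomputable section

namespace CFinsler

namespace FinslerAlg

variable {A : Type*} [CommRing A] [Algebra ℂ A] (S : FinslerAlg A)

/-- The derivative along the constant real vertical direction `v`. -/
def D (v : C2) : Derivation ℂ A A := ∑ k, (v k • S.E k + star (v k) • S.Eb k)

lemma iterate_mul_of_map_eq_zero {D : Derivation ℂ A A} {f : A} (hf : D f = 0) (g : A) (n : ℕ) :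
    D^[n] (f * g) = f * D^[n] g := by
  induction n generalizing g with
  | zero => rfl
  | succ n ih =>
    rw [Function.iterate_succ_apply, Function.iterate_succ_apply, ← ih]
    simp [Derivation.leibniz, hf]

lemma D_eq_zero {f : A} (hE : ∀ k, S.E k f = 0) (hEb : ∀ k, S.Eb k f = 0) (v : C2) :
    S.D v f = 0 := by
  simp [D, Fin.sum_univ_two, Derivation.add_apply, Derivation.smul_apply, hE, hEb]

end FinslerAlg

/-- The derivative along the vertical vector `(0, v)`. -/
def vert (v : C2) (F : C2 × C2 → ℂ) (p : C2 × C2) : ℂ := fderiv ℝ F p (0, v)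

namespace FinslerOn

open SmoothAlg

variable {L : C2 × C2 → ℝ} {Ω : Set (C2 × C2)} (H : FinslerOn L Ω)

lemma repD {f : SmoothAlg Ω} {F : C2 × C2 → ℂ} (hF : Rep f F) (v : C2) :
    Rep (H.alg.D v f) (vert v F) := by
  have h : H.alg.D v f = (v 0 • H.alg.E 0 f + star (v 0) • H.alg.Eb 0 f) +
      (v 1 • H.alg.E 1 f + star (v 1) • H.alg.Eb 1 f) := by
    simp [FinslerAlg.D, Fin.sum_univ_two, Derivation.add_apply, Derivation.smul_apply]
  rw [h]
  refine ((((H.repE hF 0).smul _).add ((H.repEb hF 0).smul _)).add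
    (((H.repE hF 1).smul _).add ((H.repEb hF 1).smul _))).congr fun p _ => ?_
  rw [vert, fderiv_eq_wirt_add_wirtBar, wirt_eq, wirtBar_eq]
  simp
  ring

lemma repD_iterate {f : SmoothAlg Ω} {F : C2 × C2 → ℂ} (hF : Rep f F) (v : C2) (n : ℕ) :
    Rep ((H.alg.D v)^[n] f) ((vert v)^[n] F) := by
  induction n generalizing f F with
  | zero => exact hF
  | succ n ih => exact ih (H.repD hF v)

/-- The set where the vertical Hessian of type `(2,0)` does not vanish. -/
def nonquadratic (L : C2 × C2 → ℝ) (Ω : Set (C2 × C2)) : Set (C2 × C2) :=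
  {p | p ∈ Ω ∧ ∃ j k, dEta j (dEta k fun q => (L q : ℂ)) p ≠ 0}

include H in
lemma isOpen_nonquadratic : IsOpen (nonquadratic L Ω) := by
  have : nonquadratic L Ω =
      ⋃ j, ⋃ k, Ω ∩ (dEta j (dEta k fun q => (L q : ℂ))) ⁻¹' {0}ᶜ := by
    ext p
    simp only [nonquadratic, Set.mem_iUnion, Set.mem_inter_iff, Set.mem_preimage,
      Set.mem_compl_singleton_iff, Set.mem_ofPred_eq, exists_and_left]
  rw [this]
  exact isOpen_iUnion fun j => isOpen_iUnion fun k =>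
    (H.repEE j k).contDiffOn.continuousOn.isOpen_inter_preimage H.isOpen isOpen_compl_singleton

include H in
lemma restrict_nonquadratic : FinslerOn L (nonquadratic L Ω) :=
  H.mono (fun _ hp => hp.1) H.isOpen_nonquadratic

/-- The pointwise form of the hypotheses on torsion and curvature. -/
def Admissible (L : C2 × C2 → ℝ) (Ω : Set (C2 × C2)) : Prop :=
  (∀ p ∈ Ω, ∀ k : Fin 2,
    ∑ i, ∑ j, ∑ l, g L i l p * torsion L i j k p * p.2 j * star (p.2 l) = 0) ∧
  ∀ p ∈ Ω, ∀ k : Fin 2, riem0k00 L k p = riem000k L k p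

section

variable (hadm : Admissible L Ω)
include hadm

lemma nonquadratic_weaklyKahler : H.restrict_nonquadratic.alg.WeaklyKahler :=
  H.restrict_nonquadratic.weaklyKahler fun p hp => hadm.1 p hp.1

/-- At each point some row of the Hessian is nonzero and annihilates both θ and η; in dimension two
they are then proportional. -/
lemma nonquadratic_proportional :
    H.restrict_nonquadratic.alg.θ 0 * H.restrict_nonquadratic.alg.y 1 =
      H.restrict_nonquadratic.alg.θ 1 * H.restrict_nonquadratic.alg.y 0 := by
  have hC := H.restrict_nonquadratic.curvatureFlat (H.nonquadratic_weaklyKahler hadm)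
    fun p hp => hadm.2 p hp.1
  have hy := H.restrict_nonquadratic.repy
  have hEE := H.restrict_nonquadratic.repEE
  have hyE := H.restrict_nonquadratic.alg.y_E_E
  refine ext_of_rep ((rep_ext _).mul (hy 1)) (((rep_ext _).mul (hy 0)).congr fun q hq => ?_)
  obtain ⟨j, k, hjk⟩ := hq.2
  have e1 := ((hEE j 0).mul (rep_ext (H.restrict_nonquadratic.alg.θ 0))).add
    ((hEE j 1).mul (rep_ext (H.restrict_nonquadratic.alg.θ 1)))
  rw [hC j] at e1
  have e2 := ((hy 0).mul (hEE j 0)).add ((hy 1).mul (hEE j 1))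
  rw [hyE j] at e2
  have e1 := e1.eqOn rep_zero hq
  have e2 := e2.eqOn rep_zero hq
  beta_reduce at e1 e2 ⊢
  have hab : dEta j (dEta 0 fun q => (L q : ℂ)) q ≠ 0 ∨ dEta j (dEta 1 fun q => (L q : ℂ)) q ≠ 0 := by
    fin_cases k
    · exact Or.inl hjk
    · exact Or.inr hjk
  generalize dEta j (dEta 0 fun q => (L q : ℂ)) q = a at *
  generalize dEta j (dEta 1 fun q => (L q : ℂ)) q = b at *
  rcases hab with h | h
  · apply mul_left_cancel₀ h
    linear_combination ext (H.restrict_nonquadratic.alg.θ 1) q * e2 - q.2 1 * e1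
  · apply mul_left_cancel₀ h
    linear_combination q.2 0 * e1 - ext (H.restrict_nonquadratic.alg.θ 0) q * e2

include H in
lemma fderiv_invK_of_nonquadratic {p : C2 × C2} (hp : p ∈ nonquadratic L Ω) :
    fderiv ℝ (invK L) p = 0 := by
  have hW := H.nonquadratic_weaklyKahler hadm
  have hθ := H.nonquadratic_proportional hadm
  have hK := H.restrict_nonquadratic.repK
  have h1 : ∀ k, dz k (invK L) p = 0 := fun k => by
    have := H.restrict_nonquadratic.repZ hK k
    rw [FinslerAlg.Z_K_eq_zero _ hW hθ] at this
    exact this.eqOn rep_zero hp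
  have h2 : ∀ k, dzBar k (invK L) p = 0 := fun k => by
    have := H.restrict_nonquadratic.repZb hK k
    rw [FinslerAlg.Zb_K_eq_zero _ hW hθ] at this
    exact this.eqOn rep_zero hp
  have h3 : ∀ k, dEta k (invK L) p = 0 := fun k => by
    have := H.restrict_nonquadratic.repE hK k
    rw [FinslerAlg.E_K_eq_zero _ hW hθ] at this
    exact this.eqOn rep_zero hp
  have h4 : ∀ k, dEtaBar k (invK L) p = 0 := fun k => by
    have := H.restrict_nonquadratic.repEb hK k
    rw [FinslerAlg.Eb_K_eq_zero _ hW hθ] at this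
    exact this.eqOn rep_zero hp
  refine ContinuousLinearMap.ext fun u => ?_
  rw [fderiv_eq_wirt_add_wirtBar, wirt_eq, wirtBar_eq]
  simp [h1, h2, h3, h4]

include H in
lemma nonquadratic_iterate (v : C2) (n : ℕ) {p : C2 × C2} (hp : p ∈ nonquadratic L Ω) :
    (vert v)^[n] (fun q => invK L q * (L q : ℂ) ^ 2) p =
      invK L p * (vert v)^[n] (fun q => (L q : ℂ) ^ 2) p := by
  have hW := H.nonquadratic_weaklyKahler hadm
  have hθ := H.nonquadratic_proportional hadm
  set H' := H.restrict_nonquadratic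
  have hL : Rep (H'.alg.L ^ 2) (fun q => (L q : ℂ) ^ 2) := by
    simp only [pow_two]; exact H'.repL.mul H'.repL
  have e := H'.repD_iterate (H'.repK.mul hL) v n
  rw [FinslerAlg.iterate_mul_of_map_eq_zero
    (H'.alg.D_eq_zero (H'.alg.E_K_eq_zero hW hθ) (H'.alg.Eb_K_eq_zero hW hθ) v)] at e
  exact e.eqOn (H'.repK.mul (H'.repD_iterate hL v n)) hp

include H in
/-- Along vertical lines `u = K L ^ 2` and `w = L ^ 2` satisfy `u⁽⁵⁾ = K w⁽⁵⁾`. -/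
lemma vert_five (v : C2) {p : C2 × C2} (hp : p ∈ Ω) :
    (vert v)^[5] (fun q => invK L q * (L q : ℂ) ^ 2) p =
      invK L p * (vert v)^[5] (fun q => (L q : ℂ) ^ 2) p := by
  have hL : Rep (H.alg.L ^ 2) (fun q => (L q : ℂ) ^ 2) := by
    simp only [pow_two]; exact H.repL.mul H.repL
  -- On this open set the Hessian is identically zero, so K L² and L² have degree at most four and
  -- both fifth derivatives vanish.
  set W : Set (C2 × C2) := Ω ∩ (closure (nonquadratic L Ω))ᶜ
  have hWo : IsOpen W := H.isOpen.inter isClosed_closure.isOpen_compl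
  have HW : FinslerOn L W := H.mono Set.inter_subset_left hWo
  have hq : ∀ k l, HW.alg.E k (HW.alg.E l HW.alg.L) = 0 := fun k l =>
    ext_of_rep (HW.repEE k l) (rep_zero.congr fun q hq => by
      by_contra hne
      exact hq.2 (subset_closure ⟨hq.1, k, l, fun h => hne h.symm⟩))
  have hLW : Rep (HW.alg.L ^ 2) (fun q => (L q : ℂ) ^ 2) := by
    simp only [pow_two]; exact HW.repL.mul HW.repL
  have hflat : ∀ q ∈ W, (vert v)^[5] (fun q => invK L q * (L q : ℂ) ^ 2) q =
      invK L q * (vert v)^[5] (fun q => (L q : ℂ) ^ 2) q := by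
    intro q hqW
    have e1 := HW.repD_iterate (HW.repK.mul hLW) v 5
    have e2 := HW.repD_iterate hLW v 5
    rw [FinslerAlg.D, (HW.alg.degLT_K_L hq).iterate] at e1
    rw [FinslerAlg.D, (HW.alg.degLT_L_sq hq).iterate] at e2
    rw [← e1 q hqW, ← e2 q hqW]
    exact (mul_zero _).symm
  have c1 : ContinuousOn ((vert v)^[5] (fun q => invK L q * (L q : ℂ) ^ 2)) Ω :=
    (H.repD_iterate (H.repK.mul hL) v 5).contDiffOn.continuousOn
  have c2 : ContinuousOn (fun p => invK L p * (vert v)^[5] (fun q => (L q : ℂ) ^ 2) p) Ω :=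
    (H.repK.mul (H.repD_iterate hL v 5)).contDiffOn.continuousOn
  have hEq : Set.EqOn ((vert v)^[5] (fun q => invK L q * (L q : ℂ) ^ 2))
      (fun p => invK L p * (vert v)^[5] (fun q => (L q : ℂ) ^ 2) p) (nonquadratic L Ω ∪ W) := by
    rintro q (hq | hq)
    · exact H.nonquadratic_iterate hadm v 5 hq
    · exact hflat q hq
  -- The closure of the nonquadratic set and its complement cover Ω, so the union is dense there and
  -- continuity concludes.
  refine hEq.of_subset_closure c1 c2 ?_ ?_ hp
  · rintro q (hq | hq)
    exacts [hq.1, hq.1]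
  · intro q hq
    by_cases h : q ∈ closure (nonquadratic L Ω)
    · exact closure_mono Set.subset_union_left h
    · exact subset_closure (Or.inr ⟨hq, h⟩)

end
end FinslerOn
end CFinsler
end

/-! ### Propagation of the value of K along a fibre. -/

noncomputable section

namespace CFinsler
namespace FinslerOn

open SmoothAlg

variable {L : C2 × C2 → ℝ} {Ω : Set (C2 × C2)} (H : FinslerOn L Ω)

lemma hasDerivAt_vert {F : C2 × C2 → ℂ} {z η v : C2} {t : ℝ}
    (hF : DifferentiableAt ℝ F (z, η + t • v)) :
    HasDerivAt (fun s : ℝ => F (z, η + s • v)) (vert v F (z, η + t • v)) t := by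
  have h1 : HasDerivAt (fun s : ℝ => η + s • v) v t := by
    simpa using ((hasDerivAt_id t).smul_const v).const_add η
  have h2 : HasDerivAt (fun s : ℝ => (z, η + s • v)) ((0 : C2), v) t :=
    (hasDerivAt_const t z).prodMk h1
  exact hF.hasFDerivAt.comp_hasDerivAt t h2

variable (hadm : Admissible L Ω)

include H hadm in
-- With c the value of K at the start and w = L², G = (K - c) w satisfies G⁽⁵⁾ = (w⁽⁵⁾/w) G by
-- `vert_five`. All its derivatives vanish at the start, so uniqueness for linear equations gives G
-- = 0.
lemma invK_eq_of_segment {z η v : C2} (h0 : (z, η) ∈ nonquadratic L Ω)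
    (hseg : ∀ t ∈ Set.Icc (0 : ℝ) 1, (z, η + t • v) ∈ Ω) :
    invK L (z, η + v) = invK L (z, η) := by
  set c := invK L (z, η) with hc
  have hL : Rep (H.alg.L ^ 2) (fun q => (L q : ℂ) ^ 2) := by
    simp only [pow_two]; exact H.repL.mul H.repL
  set w : C2 × C2 → ℂ := fun q => (L q : ℂ) ^ 2 with hw
  set G : C2 × C2 → ℂ := fun q => invK L q * w q - c * w q with hG
  have hRG : Rep (H.alg.K * H.alg.L ^ 2 - c • H.alg.L ^ 2) G := (H.repK.mul hL).sub (hL.smul c)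
  have hiter : ∀ n, ∀ q ∈ Ω, (vert v)^[n] G q =
      (vert v)^[n] (fun q => invK L q * w q) q - c * (vert v)^[n] w q := by
    intro n q hq
    have e1 := H.repD_iterate hRG v n
    have hs : ∀ m, ∀ f : SmoothAlg Ω, (H.alg.D v)^[m] (c • f) = c • (H.alg.D v)^[m] f := by
      intro m
      induction m with
      | zero => intro f; rfl
      | succ m ih => intro f; simp only [Function.iterate_succ_apply, Derivation.map_smul, ih]
    rw [iterate_map_sub, hs] at e1
    exact e1.eqOn ((H.repD_iterate (H.repK.mul hL) v n).sub
      ((H.repD_iterate hL v n).smul c)) hq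
  set γ : ℝ → C2 × C2 := fun t => (z, η + t • v) with hγ
  have hγc : Continuous γ := by fun_prop
  set a : ℝ → ℂ := fun t => (vert v)^[5] w (γ t) / w (γ t) with ha
  have hwne : ∀ q ∈ Ω, w q ≠ 0 := fun q hq => pow_ne_zero 2 (H.ofReal_ne_zero hq)
  have hac : ContinuousOn a (Set.Icc 0 1) := by
    refine ContinuousOn.div ?_ ?_ fun t ht => hwne _ (hseg t ht)
    · exact (H.repD_iterate hL v 5).contDiffOn.continuousOn.comp hγc.continuousOn hseg
    · exact hL.contDiffOn.continuousOn.comp hγc.continuousOn hseg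
  obtain ⟨B, hB⟩ := isCompact_Icc.exists_bound_of_continuousOn hac
  have hder : ∀ n, ∀ t ∈ Set.Icc (0 : ℝ) 1,
      HasDerivAt (fun s => (vert v)^[n] G (γ s)) ((vert v)^[n + 1] G (γ t)) t := by
    intro n t ht
    rw [Function.iterate_succ_apply']
    exact hasDerivAt_vert ((H.repD_iterate hRG v n).differentiableAt H.isOpen (hseg t ht))
  have hfive : ∀ t ∈ Set.Icc (0 : ℝ) 1, (vert v)^[5] G (γ t) = a t * G (γ t) := by
    intro t ht
    have hne := hwne _ (hseg t ht)
    have e : a t * w (γ t) = (vert v)^[5] w (γ t) := div_mul_cancel₀ _ hne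
    rw [hiter 5 _ (hseg t ht), H.vert_five hadm v (hseg t ht)]
    simp only [hG]
    linear_combination (-(invK L (γ t)) + c) * e
  set y : ℝ → Fin 5 → ℂ := fun t i => (vert v)^[(i : ℕ)] G (γ t) with hy
  set y' : ℝ → Fin 5 → ℂ := fun t i => (vert v)^[(i : ℕ) + 1] G (γ t) with hy'
  have hyd : ∀ t ∈ Set.Icc (0 : ℝ) 1, HasDerivAt y (y' t) t := fun t ht =>
    hasDerivAt_pi.2 fun i => hder i t ht
  have hy0 : y 0 = 0 := by
    funext i
    have hp : γ 0 ∈ Ω := hseg 0 (by simp)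
    have hγ0 : γ 0 = (z, η) := by simp [hγ]
    have := H.nonquadratic_iterate hadm v i h0
    simp only [hy, hiter i _ hp, hγ0]
    rw [← hw] at this
    rw [this, sub_self]; rfl
  -- In the first order system for (G, ..., G⁽⁴⁾) the derivative shifts the first four entries,
  -- costing the factor 1, and the last one is a G, costing at most B.
  have hbound : ∀ t ∈ Set.Ico (0 : ℝ) 1, ‖y' t‖ ≤ (max 1 B) * ‖y t‖ := by
    intro t ht
    have ht' : t ∈ Set.Icc (0 : ℝ) 1 := ⟨ht.1, ht.2.le⟩
    refine (pi_norm_le_iff_of_nonneg (by positivity)).2 fun i => ?_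
    by_cases hi : (i : ℕ) + 1 < 5
    · calc ‖y' t i‖ = ‖y t ⟨i + 1, hi⟩‖ := rfl
        _ ≤ 1 * ‖y t‖ := by rw [one_mul]; exact norm_le_pi_norm _ _
        _ ≤ _ := by gcongr; exact le_max_left _ _
    · have hi4 : (i : ℕ) + 1 = 5 := by omega
      have : y' t i = a t * y t 0 := by
        simp only [hy', hi4]
        exact hfive t ht'
      rw [this, norm_mul]
      gcongr
      · exact (hB t ht').trans (le_max_right _ _)
      · exact norm_le_pi_norm _ _
  have hzero := eq_zero_of_abs_deriv_le_mul_abs_self_of_eq_zero_right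
    (fun t ht => (hyd t ht).continuousAt.continuousWithinAt)
    (fun t ht => (hyd t ⟨ht.1, ht.2.le⟩).hasDerivWithinAt) hy0 hbound 1 (by simp)
  have h1 : G (γ 1) = 0 := congrFun hzero 0
  have hp : γ 1 ∈ Ω := hseg 1 (by simp)
  have hγ1 : γ 1 = (z, η + v) := by simp [hγ]
  have h2 : (invK L (γ 1) - c) * w (γ 1) = 0 := by simp only [hG] at h1; linear_combination h1
  have h3 := (mul_eq_zero.1 h2).resolve_right (hwne _ hp)
  rw [hγ1] at h3
  exact sub_eq_zero.1 h3

/-- The part of `C2 × C2` over `U` with the zero section removed. -/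
def slit (U : Set C2) : Set (C2 × C2) := {p | p.1 ∈ U ∧ p.2 ≠ 0}

lemma isOpen_slit {U : Set C2} (hU : IsOpen U) : IsOpen (slit U) :=
  (hU.preimage continuous_fst).inter (isOpen_compl_singleton.preimage continuous_snd)

/-- The segment from η₀ to η may cross the zero section. Tilting its end by i s η₀ repairs this,
because at most one real s lets the line through η₀ and the tilted end meet 0. -/
lemma segment_avoids_zero {η₀ η : C2} (h0 : η₀ ≠ 0) :
    ∀ᶠ s : ℝ in nhdsWithin 0 {0}ᶜ, ∀ t ∈ Set.Icc (0 : ℝ) 1,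
      η₀ + t • (η + ((s : ℂ) * Complex.I) • η₀ - η₀) ≠ 0 := by
  have huniq : ∀ s s' : ℝ, ∀ t t' : ℝ, η₀ + t • (η + ((s : ℂ) * Complex.I) • η₀ - η₀) = 0 →
      η₀ + t' • (η + ((s' : ℂ) * Complex.I) • η₀ - η₀) = 0 → s = s' := by
    intro s s' t t' h h'
    obtain ⟨i, hi⟩ : ∃ i, η₀ i ≠ 0 := by
      by_contra! hc
      exact h0 (funext hc)
    have e := congrFun h i
    have e' := congrFun h' i
    simp only [Pi.add_apply, Pi.smul_apply, Pi.sub_apply, Pi.zero_apply, smul_eq_mul,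
      Complex.real_smul] at e e'
    -- Eliminating η from the two equations leaves a scalar identity with imaginary part t t' (s -
    -- s').
    have key : ((t' : ℂ) * (1 - t) - t * (1 - t') + t * t' * ((s : ℂ) - s') * Complex.I) = 0 := by
      apply mul_right_cancel₀ hi
      linear_combination (t' : ℂ) * e - t * e'
    have him := congrArg Complex.im key
    simp at him
    have ht : t ≠ 0 := by
      rintro rfl
      apply h0; simpa using h
    have ht' : t' ≠ 0 := by
      rintro rfl
      apply h0; simpa using h'
    have := him.resolve_left (by tauto)
    linarith
  by_cases hbad : ∃ b t : ℝ, η₀ + t • (η + ((b : ℂ) * Complex.I) • η₀ - η₀) = 0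
  · obtain ⟨b, t, hb⟩ := hbad
    by_cases hb0 : b = 0
    · filter_upwards [self_mem_nhdsWithin] with s hs t' _ h
      exact hs ((huniq s b t' t h hb).trans hb0)
    · filter_upwards [nhdsWithin_le_nhds (eventually_ne_nhds (Ne.symm hb0))] with s hs t' _ h
      exact hs (huniq s b t' t h hb)
  · push Not at hbad
    exact Filter.Eventually.of_forall fun s t _ => hbad s t

/-- The tilted ends tend to η as s → 0, and K is continuous at (z, η). -/
lemma invK_eq_of_fibre {U : Set C2} (H : FinslerOn L (slit U)) (hadm : Admissible L (slit U))
    {z η₀ η : C2} (h0 : (z, η₀) ∈ nonquadratic L (slit U)) (hη : η ≠ 0) :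
    invK L (z, η) = invK L (z, η₀) := by
  have hz : z ∈ U := h0.1.1
  set f : ℝ → C2 × C2 := fun s => (z, η + ((s : ℂ) * Complex.I) • η₀) with hf
  have hfc : Continuous f := by fun_prop
  have hf0 : f 0 = (z, η) := by simp [hf]
  have hcont : ContinuousAt (invK L) (f 0) := by
    rw [hf0]
    exact (H.contDiffOn_invK.contDiffAt (H.isOpen.mem_nhds ⟨hz, hη⟩)).continuousAt
  have h1 : Filter.Tendsto (fun s => invK L (f s)) (nhdsWithin 0 {0}ᶜ)
      (nhds (invK L (z, η))) := by
    have : Filter.Tendsto (fun s => invK L (f s)) (nhds 0) (nhds (invK L (f 0))) :=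
      hcont.comp hfc.continuousAt
    rw [hf0] at this
    exact this.mono_left nhdsWithin_le_nhds
  have h2 : (fun s => invK L (f s)) =ᶠ[nhdsWithin 0 {0}ᶜ] fun _ => invK L (z, η₀) := by
    filter_upwards [segment_avoids_zero (η := η) h0.1.2] with s hs
    have := H.invK_eq_of_segment hadm (v := η + ((s : ℂ) * Complex.I) • η₀ - η₀) h0
      fun t ht => ⟨hz, hs t ht⟩
    rw [add_sub_cancel] at this
    exact this
  exact tendsto_nhds_unique h1 (tendsto_const_nhds.congr' h2.symm)

/-- Near the base point of a direction where `A` does not vanish, the curvature invariant is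
locally constant. -/
theorem eventually_fderiv_invK_eq_zero {U : Set C2} (H : FinslerOn L (slit U))
    (hadm : Admissible L (slit U)) {p : C2 × C2} (hp : p ∈ slit U) (hA : termA L p ≠ 0) :
    ∀ᶠ z in nhds p.1, ∀ η : C2, η ≠ 0 → fderiv ℝ (invK L) (z, η) = 0 := by
  have hO := H.isOpen_nonquadratic
  have hpO : (p.1, p.2) ∈ nonquadratic L (slit U) := ⟨hp, H.exists_hessian_ne_zero hp hA⟩
  have hV : IsOpen {z | (z, p.2) ∈ nonquadratic L (slit U)} := hO.preimage (by fun_prop)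
  filter_upwards [hV.mem_nhds hpO] with z hz η hη
  -- Near (z, η), K agrees with its value at the fixed fibre vector p.2, so its differential factors
  -- through a nonquadratic point, where dK = 0.
  set ι : C2 × C2 → C2 × C2 := fun q => (q.1, p.2)
  have hι : DifferentiableAt ℝ ι (z, η) := by fun_prop
  have heq : invK L =ᶠ[nhds (z, η)] invK L ∘ ι := by
    have hVs : IsOpen (slit {z | (z, p.2) ∈ nonquadratic L (slit U)}) := isOpen_slit hV
    filter_upwards [hVs.mem_nhds ⟨hz, hη⟩] with q hq
    exact invK_eq_of_fibre H hadm hq.1 hq.2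
  have hz' : ι (z, η) ∈ nonquadratic L (slit U) := hz
  have hd : DifferentiableAt ℝ (invK L) (ι (z, η)) :=
    differentiableAt_of_smoothOn H.isOpen H.contDiffOn_invK hz'.1
  rw [heq.fderiv_eq, fderiv_comp _ hd hι, H.fderiv_invK_of_nonquadratic hadm hz',
    ContinuousLinearMap.zero_comp]

end FinslerOn
end CFinsler
end

noncomputable section

namespace CFinsler

/-! ### Holomorphic changes of coordinates -/

lemma fderiv_real_smul_I {E F : Type*} [NormedAddCommGroup E] [NormedSpace ℂ E]
    [NormedAddCommGroup F] [NormedSpace ℂ F] {h : E → F} {p : E}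
    (hh : DifferentiableAt ℂ h p) (u : E) : fderiv ℝ h p u = fderiv ℂ h p u := by
  rw [hh.fderiv_restrictScalars ℝ]; rfl

lemma wirtBar_of_holomorphic {h : C2 × C2 → ℂ} {p : C2 × C2} (hh : DifferentiableAt ℂ h p)
    (u : C2 × C2) : wirtBar u h p = 0 := by
  simp only [wirtBar, fderiv_real_smul_I hh, map_smul, smul_eq_mul]
  linear_combination (1 / 2) * fderiv ℂ h p u * Complex.I_sq

variable {T : C2 × C2 → C2 × C2} {f : C2 × C2 → ℂ} {p : C2 × C2}

lemma fderiv_comp_holomorphic (hT : DifferentiableAt ℂ T p) (hf : DifferentiableAt ℝ f (T p))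
    (u : C2 × C2) : fderiv ℝ (fun q => f (T q)) p u = fderiv ℝ f (T p) (fderiv ℂ T p u) := by
  have := fderiv_comp p hf (hT.restrictScalars ℝ)
  change fderiv ℝ (f ∘ T) p u = _
  rw [this, ContinuousLinearMap.comp_apply, fderiv_real_smul_I hT]

lemma wirt_comp_holomorphic (hT : DifferentiableAt ℂ T p) (hf : DifferentiableAt ℝ f (T p))
    (u : C2 × C2) : wirt u (fun q => f (T q)) p = wirt (fderiv ℂ T p u) f (T p) := by
  simp only [wirt, fderiv_comp_holomorphic hT hf, map_smul]

lemma wirtBar_comp_holomorphic (hT : DifferentiableAt ℂ T p) (hf : DifferentiableAt ℝ f (T p))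
    (u : C2 × C2) : wirtBar u (fun q => f (T q)) p = wirtBar (fderiv ℂ T p u) f (T p) := by
  simp only [wirtBar, fderiv_comp_holomorphic hT hf, map_smul]

/-- The Levi form of `f` along `w`. -/
def levi (f : C2 × C2 → ℂ) (p w : C2 × C2) : ℂ := wirtBar w (wirt w f) p

/-- Holomorphic coefficients pass through (0,1)-derivatives; this is why Levi forms transform
without second derivatives of the map. -/
lemma wirtBar_mul_add {a₁ a₂ a₃ a₄ f₁ f₂ f₃ f₄ : C2 × C2 → ℂ} (w : C2 × C2)
    (ha₁ : DifferentiableAt ℂ a₁ p) (ha₂ : DifferentiableAt ℂ a₂ p)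
    (ha₃ : DifferentiableAt ℂ a₃ p) (ha₄ : DifferentiableAt ℂ a₄ p)
    (hf₁ : DifferentiableAt ℝ f₁ p) (hf₂ : DifferentiableAt ℝ f₂ p)
    (hf₃ : DifferentiableAt ℝ f₃ p) (hf₄ : DifferentiableAt ℝ f₄ p) :
    wirtBar w (fun q => (a₁ q * f₁ q + a₂ q * f₂ q) + (a₃ q * f₃ q + a₄ q * f₄ q)) p =
      (a₁ p * wirtBar w f₁ p + a₂ p * wirtBar w f₂ p) +
      (a₃ p * wirtBar w f₃ p + a₄ p * wirtBar w f₄ p) := by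
  have z₁ := wirtBar_of_holomorphic ha₁ w
  have z₂ := wirtBar_of_holomorphic ha₂ w
  have z₃ := wirtBar_of_holomorphic ha₃ w
  have z₄ := wirtBar_of_holomorphic ha₄ w
  replace ha₁ := ha₁.restrictScalars ℝ
  replace ha₂ := ha₂.restrictScalars ℝ
  replace ha₃ := ha₃.restrictScalars ℝ
  replace ha₄ := ha₄.restrictScalars ℝ
  rw [wirtBar_eq_firstOrder] at *
  rw [firstOrder_add _ _ _ _ ((ha₁.fun_mul hf₁).fun_add (ha₂.fun_mul hf₂))
      ((ha₃.fun_mul hf₃).fun_add (ha₄.fun_mul hf₄)),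
    firstOrder_add _ _ _ _ (ha₁.fun_mul hf₁) (ha₂.fun_mul hf₂),
    firstOrder_add _ _ _ _ (ha₃.fun_mul hf₃) (ha₄.fun_mul hf₄),
    firstOrder_mul _ _ _ _ ha₁ hf₁, firstOrder_mul _ _ _ _ ha₂ hf₂,
    firstOrder_mul _ _ _ _ ha₃ hf₃, firstOrder_mul _ _ _ _ ha₄ hf₄, z₁, z₂, z₃, z₄]
  ring

lemma levi_eq_sum {Ω : Set (C2 × C2)} (hΩ : IsOpen Ω) (hf : ContDiffOn ℝ ∞ f Ω) (hp : p ∈ Ω)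
    (v w : C2 × C2) : wirtBar v (wirt w f) p =
      (w.1 0 * wirtBar v (dz 0 f) p + w.1 1 * wirtBar v (dz 1 f) p) +
      (w.2 0 * wirtBar v (dEta 0 f) p + w.2 1 * wirtBar v (dEta 1 f) p) := by
  have hd : ∀ u, DifferentiableAt ℝ (wirt u f) p := fun u => by
    rw [wirt_eq_firstOrder]
    exact differentiableAt_of_smoothOn hΩ (contDiffOn_firstOrder _ _ _ _ hΩ hf) hp
  have : wirt w f = fun q => (w.1 0 * dz 0 f q + w.1 1 * dz 1 f q) +
      (w.2 0 * dEta 0 f q + w.2 1 * dEta 1 f q) := funext fun q => wirt_eq w f q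
  rw [this]
  exact wirtBar_mul_add v (differentiableAt_const _) (differentiableAt_const _)
    (differentiableAt_const _) (differentiableAt_const _) (hd _) (hd _) (hd _) (hd _)

/-- The Levi form is invariant under holomorphic maps. -/
lemma levi_comp_holomorphic {V Ω : Set (C2 × C2)} (hV : IsOpen V) (hΩ : IsOpen Ω)
    (hT : ContDiffOn ℂ 2 T V) (hVΩ : Set.MapsTo T V Ω) (hf : ContDiffOn ℝ ∞ f Ω) (hp : p ∈ V)
    (w : C2 × C2) : levi (fun q => f (T q)) p w = levi f (T p) (fderiv ℂ T p w) := by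
  have hTd : ∀ q ∈ V, DifferentiableAt ℂ T q := fun q hq =>
    (hT.contDiffAt (hV.mem_nhds hq)).differentiableAt (by norm_num)
  have hTw : DifferentiableAt ℂ (fun q => fderiv ℂ T q w) p := by
    have : ContDiffAt ℂ 1 (fderiv ℂ T) p :=
      (hT.contDiffAt (hV.mem_nhds hp)).fderiv_right (by norm_num)
    exact (this.differentiableAt (by norm_num)).clm_apply (differentiableAt_const _)
  have h1 : ∀ i, DifferentiableAt ℂ (fun q => (fderiv ℂ T q w).1 i) p := fun i =>
    differentiableAt_pi.1 hTw.fst i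
  have h2 : ∀ i, DifferentiableAt ℂ (fun q => (fderiv ℂ T q w).2 i) p := fun i =>
    differentiableAt_pi.1 hTw.snd i
  have hd : ∀ u, DifferentiableAt ℝ (wirt u f) (T p) := fun u => by
    rw [wirt_eq_firstOrder]
    exact differentiableAt_of_smoothOn hΩ (contDiffOn_firstOrder _ _ _ _ hΩ hf) (hVΩ hp)
  have hTp := (hTd p hp).restrictScalars ℝ
  have hdT : ∀ u, DifferentiableAt ℝ (fun q => wirt u f (T q)) p := fun u =>
    (hd u).comp p hTp
  have heq : Set.EqOn (wirt w fun q => f (T q)) (fun q =>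
      ((fderiv ℂ T q w).1 0 * dz 0 f (T q) + (fderiv ℂ T q w).1 1 * dz 1 f (T q)) +
      ((fderiv ℂ T q w).2 0 * dEta 0 f (T q) + (fderiv ℂ T q w).2 1 * dEta 1 f (T q))) V := by
    intro q hq
    rw [wirt_comp_holomorphic (hTd q hq) (differentiableAt_of_smoothOn hΩ hf (hVΩ hq)), wirt_eq]
  rw [levi, wirtBar_eq_firstOrder, firstOrder_congr _ _ _ _ hV heq hp, ← wirtBar_eq_firstOrder]
  refine (wirtBar_mul_add w (h1 0) (h1 1) (h2 0) (h2 1) (hdT (Pi.single 0 1, 0))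
    (hdT (Pi.single 1 1, 0)) (hdT (0, Pi.single 0 1)) (hdT (0, Pi.single 1 1))).trans ?_
  rw [levi, levi_eq_sum hΩ hf (hVΩ hp)]
  simp only [dz, dEta]
  rw [wirtBar_comp_holomorphic (hTd p hp) (hd _), wirtBar_comp_holomorphic (hTd p hp) (hd _),
    wirtBar_comp_holomorphic (hTd p hp) (hd _), wirtBar_comp_holomorphic (hTd p hp) (hd _)]

namespace FinslerOn

open SmoothAlg

variable {L : C2 × C2 → ℝ} {Ω : Set (C2 × C2)} (H : FinslerOn L Ω)

/-- The coefficients `N^i_0`. -/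
def connZero (L : C2 × C2 → ℝ) (p : C2 × C2) : C2 := fun i => ∑ k, N L i k p * p.2 k

include H in
lemma levi_eq {p : C2 × C2} (hp : p ∈ Ω) (ξ : C2) :
    levi (fun q => (L q : ℂ)) p (p.2, ξ) = - (invK L p * (L p : ℂ) ^ 2) +
      ∑ i, ∑ j, (ξ i + connZero L p i) * (star (ξ j) + star (connZero L p j)) * g L i j p := by
  have hL : Rep (H.alg.L ^ 2) (fun q => (L q : ℂ) ^ 2) := by
    simp only [pow_two]; exact H.repL.mul H.repL
  have e := H.alg.levi_eq (fun i => algebraMap ℂ _ (ξ i)) (fun i => algebraMap ℂ _ (star (ξ i)))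
  have r1 := (((Rep.sum (s := Finset.univ) fun h => Rep.sum (s := Finset.univ) fun k =>
    ((H.repyb h).mul (H.repy k)).mul (H.repZb (H.repZ H.repL k) h)).add
    (Rep.sum (s := Finset.univ) fun k => Rep.sum (s := Finset.univ) fun l =>
      ((H.repy k).mul (rep_const (star (ξ l)))).mul (H.repEb (H.repZ H.repL k) l))).add
    (Rep.sum (s := Finset.univ) fun h => Rep.sum (s := Finset.univ) fun l =>
      ((H.repyb h).mul (rep_const (ξ l))).mul (H.repZb (H.repE H.repL l) h))).add
    (Rep.sum (s := Finset.univ) fun i => Rep.sum (s := Finset.univ) fun j =>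
      ((rep_const (ξ i)).mul (rep_const (star (ξ j)))).mul (H.repg i j))
  have r2 := (H.repK.mul hL).neg.add
    (Rep.sum (s := Finset.univ) fun i => Rep.sum (s := Finset.univ) fun j =>
      (((rep_const (ξ i)).add (H.repN0 i)).mul
        ((rep_const (star (ξ j))).add (H.repN0 j).conj)).mul (H.repg i j))
  rw [e] at r1
  have := r1.eqOn r2 hp
  beta_reduce at this
  change _ = - (invK L p * (L p : ℂ) ^ 2) + ∑ i, ∑ j,
    (ξ i + connZero L p i) * (star (ξ j) + star (connZero L p j)) * g L i j p at this
  rw [← this, levi, levi_eq_sum H.isOpen H.contDiffOn_ofReal hp]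
  simp only [wirtBar_eq, Fin.sum_univ_two]
  change _ = _ + (ξ 0 * star (ξ 0) * dEtaBar 0 (dEta 0 fun q => (L q : ℂ)) p +
      ξ 0 * star (ξ 1) * dEtaBar 1 (dEta 0 fun q => (L q : ℂ)) p +
    (ξ 1 * star (ξ 0) * dEtaBar 0 (dEta 1 fun q => (L q : ℂ)) p +
      ξ 1 * star (ξ 1) * dEtaBar 1 (dEta 1 fun q => (L q : ℂ)) p))
  ring

include H in
lemma quadratic_nonneg {p : C2 × C2} (hp : p ∈ Ω) (x : C2) :
    0 ≤ ∑ i, ∑ j, x i * star (x j) * g L i j p := by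
  have h := (H.posDef p hp).posSemidef.dotProduct_mulVec_nonneg (star x)
  convert h using 1
  simp only [dotProduct, Matrix.mulVec, g, Fin.sum_univ_two, Pi.star_apply, star_star]
  ring

include H in
/-- The curvature invariant does not increase under the inverse of a holomorphic map. -/
lemma invK_le_of_holomorphic {L' : C2 × C2 → ℝ} {Ω' V : Set (C2 × C2)} (H' : FinslerOn L' Ω')
    (hV : IsOpen V) {T : C2 × C2 → C2 × C2} (hT : ContDiffOn ℂ 2 T V) (hVΩ : Set.MapsTo T V Ω')
    {p : C2 × C2} (hp : p ∈ V) (hpΩ : p ∈ Ω) (hL : ∀ q ∈ V, L q = L' (T q))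
    (hT1 : ∀ ξ, (fderiv ℂ T p (p.2, ξ)).1 = (T p).2) :
    (invK L p).re ≤ (invK L' (T p)).re := by
  -- The minimiser: the square in `levi_eq` vanishes at p, while the square at T p is only
  -- nonnegative, which gives the inequality.
  set ξ : C2 := - connZero L p
  have e1 := H.levi_eq hpΩ ξ
  have hz : ∀ i, ξ i + connZero L p i = 0 := fun i => by simp [ξ]
  simp only [hz, zero_mul, Finset.sum_const_zero, add_zero] at e1
  have e2 := levi_comp_holomorphic hV H'.isOpen hT hVΩ H'.contDiffOn_ofReal hp (p.2, ξ)
  have e3 : levi (fun q => (L q : ℂ)) p (p.2, ξ) = levi (fun q => (L' (T q) : ℂ)) p (p.2, ξ) := by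
    have heq : Set.EqOn (wirt (p.2, ξ) fun q => (L q : ℂ))
        (wirt (p.2, ξ) fun q => (L' (T q) : ℂ)) V := by
      intro q hq
      rw [wirt_eq_firstOrder]
      exact firstOrder_congr _ _ _ _ hV (fun q hq => by simp [hL q hq]) hq
    rw [levi, levi, wirtBar_eq_firstOrder]
    exact firstOrder_congr _ _ _ _ hV heq hp
  set w := fderiv ℂ T p (p.2, ξ)
  have hw : w = ((T p).2, w.2) := Prod.ext (hT1 ξ) rfl
  rw [hw, H'.levi_eq (hVΩ hp) w.2] at e2
  have e4 := e1.symm.trans (e3.trans e2)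
  have hq := H'.quadratic_nonneg (hVΩ hp) (fun i => w.2 i + connZero L' (T p) i)
  simp only [star_add] at hq
  have hre := congrArg Complex.re e4
  have hq' := (Complex.le_def.1 hq).1
  have hl : (L p : ℂ) = (L' (T p) : ℂ) := by rw [hL p hp]
  rw [Complex.add_re, hl, Complex.neg_re, Complex.neg_re, ← Complex.ofReal_pow,
    Complex.re_mul_ofReal, Complex.re_mul_ofReal] at hre
  have hpos : 0 < L' (T p) ^ 2 := pow_pos (H'.pos _ (hVΩ hp)) 2
  rw [Complex.zero_re] at hq'
  have : (invK L p).re * L' (T p) ^ 2 ≤ (invK L' (T p)).re * L' (T p) ^ 2 := by linarith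
  exact le_of_mul_le_mul_right this hpos

include H in
lemma invK_eq_re {p : C2 × C2} (hp : p ∈ Ω) : invK L p = ((invK L p).re : ℂ) :=
  (Complex.conj_eq_iff_re.1 (H.star_invK hp)).symm

end FinslerOn

/-- Euler's relation for an absolutely homogeneous function. -/
lemma euler_of_homogeneous {L : C2 × C2 → ℝ} {p : C2 × C2} (hL : DifferentiableAt ℝ L p)
    (hom : ∀ c : ℂ, L (p.1, c • p.2) = ‖c‖ ^ 2 * L p) :
    ∑ k, p.2 k * dEta k (fun q => (L q : ℂ)) p = (L p : ℂ) := by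
  have hd : DifferentiableAt ℝ (fun q => (L q : ℂ)) p :=
    Complex.ofRealCLM.differentiableAt.comp p hL
  -- On the complex line through η, L is |1 + s c|² L(p). The values c = 1 and c = i supply the two
  -- real derivatives in the (1,0)-derivative.
  have key : ∀ c : ℂ, fderiv ℝ (fun q => (L q : ℂ)) p (0, c • p.2) = 2 * c.re * L p := by
    intro c
    have hp : (p.1, p.2 + (0 : ℝ) • (c • p.2)) = p := by simp
    have h1 := FinslerOn.hasDerivAt_vert (F := fun q => (L q : ℂ)) (z := p.1) (η := p.2)
      (v := c • p.2) (t := 0) (by rw [hp]; exact hd)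
    rw [hp] at h1
    have h2 : (fun s : ℝ => (L (p.1, p.2 + s • c • p.2) : ℂ)) =
        fun s : ℝ => ((1 + s * c.re) ^ 2 + (s * c.im) ^ 2) * (L p : ℂ) := by
      funext s
      have : p.2 + s • c • p.2 = (1 + (s : ℂ) * c) • p.2 := by
        rw [add_smul, one_smul, mul_smul, Complex.coe_smul]
      rw [this, hom, Complex.sq_norm, Complex.normSq_apply]
      simp only [Complex.add_re, Complex.add_im, Complex.one_re, Complex.one_im,
        Complex.re_ofReal_mul, Complex.im_ofReal_mul]
      push_cast
      ring
    rw [h2] at h1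
    have h3 : HasDerivAt (fun s : ℝ => ((1 + s * c.re) ^ 2 + (s * c.im) ^ 2) * (L p : ℂ))
        (2 * (c.re : ℂ) * (L p : ℂ)) 0 := by
      have hs : HasDerivAt (fun s : ℝ => (s : ℂ)) 1 0 := Complex.ofRealCLM.hasDerivAt
      have := (((hs.mul_const (c.re : ℂ)).const_add 1).pow 2).add ((hs.mul_const (c.im : ℂ)).pow 2)
      refine HasDerivAt.congr_deriv (this.mul_const (L p : ℂ)) ?_
      simp
    exact h1.unique h3
  have h := wirt_eq (0, p.2) (fun q => (L q : ℂ)) p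
  have e1 := key 1
  have e2 := key Complex.I
  rw [one_smul] at e1
  have e3 : (Complex.I • ((0 : C2), p.2)) = (0, Complex.I • p.2) := by simp
  rw [wirt, e3, e1, e2] at h
  simp at h
  rw [Fin.sum_univ_two, ← h]

end CFinsler
end

noncomputable section

namespace CFinsler

open FinslerOn

variable {M : Type*} [TopologicalSpace M]

/-! ### Charts -/

section Charts

variable (e e' : OpenPartialHomeomorph M C2)

/-- The change of coordinates from `e` to `e'`. -/
def transition (z : C2) : C2 := e' (e.symm z)

/-- The change of the induced coordinates of the tangent bundle. -/
def tangentTransition (q : C2 × C2) : C2 × C2 :=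
  (transition e e' q.1, fderiv ℂ (transition e e') q.1 q.2)

/-- The domain of the change of coordinates. -/
def overlap : Set C2 := e.target ∩ e.symm ⁻¹' e'.source

lemma isOpen_overlap : IsOpen (overlap e e') := e.isOpen_inter_preimage_symm e'.open_source

variable {e e'}

lemma transition_mem_overlap {z : C2} (hz : z ∈ overlap e e') :
    transition e e' z ∈ overlap e' e := by
  refine ⟨e'.map_source hz.2, ?_⟩
  simp only [Set.mem_preimage, transition, e'.left_inv hz.2]
  exact e.map_target hz.1

lemma transition_transition {z : C2} (hz : z ∈ overlap e e') :
    transition e' e (transition e e' z) = z := by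
  simp only [transition, e'.left_inv hz.2, e.right_inv hz.1]

variable [ChartedSpace C2 M] (he : e ∈ holCharts M) (he' : e' ∈ holCharts M)
include he he'

lemma contDiffOn_transition : ContDiffOn ℂ ω (transition e e') (overlap e e') := by
  rw [← contMDiffOn_iff_contDiffOn]
  have h1 : ContMDiffOn 𝓘(ℂ, C2) 𝓘(ℂ, C2) ω e.symm e.target :=
    contMDiffOn_symm_of_mem_maximalAtlas he
  have h2 : ContMDiffOn 𝓘(ℂ, C2) 𝓘(ℂ, C2) ω e' e'.source :=
    contMDiffOn_of_mem_maximalAtlas he'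
  exact h2.comp (h1.mono Set.inter_subset_left) fun z hz => hz.2

lemma differentiableAt_transition {z : C2} (hz : z ∈ overlap e e') :
    DifferentiableAt ℂ (transition e e') z :=
  ((contDiffOn_transition he he').contDiffAt ((isOpen_overlap e e').mem_nhds hz)).differentiableAt
    (by simp)

lemma tangentTransition_tangentTransition {q : C2 × C2} (hq : q.1 ∈ overlap e e') :
    tangentTransition e' e (tangentTransition e e' q) = q := by
  have h1 := differentiableAt_transition he he' hq
  have h2 := differentiableAt_transition he' he (transition_mem_overlap hq)
  have hid : (transition e' e ∘ transition e e') =ᶠ[nhds q.1] id := by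
    filter_upwards [(isOpen_overlap e e').mem_nhds hq] with z hz
    exact transition_transition hz
  have h3 := fderiv_comp q.1 h2 h1
  rw [hid.fderiv_eq, fderiv_id] at h3
  refine Prod.ext (transition_transition hq) ?_
  exact (congrArg (fun A => A q.2) h3).symm

lemma tangentTransition_mem {q : C2 × C2} (hq : q ∈ slit (overlap e e')) :
    tangentTransition e e' q ∈ slit (overlap e' e) := by
  refine ⟨transition_mem_overlap hq.1, fun h => hq.2 ?_⟩
  have := congrArg Prod.snd (tangentTransition_tangentTransition he he' hq.1)
  rw [← this]
  simp only [tangentTransition] at h ⊢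
  rw [h, map_zero]

lemma contDiffOn_tangentTransition :
    ContDiffOn ℂ 2 (tangentTransition e e') (slit (overlap e e')) := by
  have h1 : ContDiffOn ℂ ω (transition e e') (overlap e e') := contDiffOn_transition he he'
  have h2 : ContDiffOn ℂ 2 (fderiv ℂ (transition e e')) (overlap e e') :=
    h1.fderiv_of_isOpen (isOpen_overlap e e') le_top
  have h3 : Set.MapsTo Prod.fst (slit (overlap e e')) (overlap e e') := fun q hq => hq.1
  refine ContDiffOn.prodMk ((h1.of_le le_top).comp contDiff_fst.contDiffOn h3) ?_
  exact (h2.comp contDiff_fst.contDiffOn h3).clm_apply contDiff_snd.contDiffOn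

/-- Vectors (η, ξ) are those lying over the tautological vector η, so chart changes preserve the
family over which the Levi form is minimised. -/
lemma fderiv_tangentTransition_fst {q : C2 × C2} (hq : q ∈ slit (overlap e e')) (ξ : C2) :
    (fderiv ℂ (tangentTransition e e') q (q.2, ξ)).1 = (tangentTransition e e' q).2 := by
  have hT : DifferentiableAt ℂ (tangentTransition e e') q :=
    ((contDiffOn_tangentTransition he he').contDiffAt
      ((isOpen_slit (isOpen_overlap e e')).mem_nhds hq)).differentiableAt (by norm_num)
  have h1 : HasFDerivAt (fun q => (tangentTransition e e' q).1) _ q := hT.hasFDerivAt.fst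
  have h2 : HasFDerivAt (fun q : C2 × C2 => transition e e' q.1) _ q :=
    (differentiableAt_transition he he' hq.1).hasFDerivAt.comp q hasFDerivAt_fst
  have h3 := h1.unique h2
  exact congrArg (fun A => A (q.2, ξ)) h3

omit he' in
lemma mdifferentiableAt_symm {z : C2} (hz : z ∈ e.target) :
    MDifferentiableAt 𝓘(ℂ, C2) 𝓘(ℂ, C2) e.symm z :=
  ((contMDiffOn_symm_of_mem_maximalAtlas he).contMDiffAt
    (e.open_target.mem_nhds hz)).mdifferentiableAt (by simp)

omit he' in
lemma mdifferentiableAt_chart {x : M} (hx : x ∈ e.source) :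
    MDifferentiableAt 𝓘(ℂ, C2) 𝓘(ℂ, C2) e x :=
  ((contMDiffOn_of_mem_maximalAtlas he).contMDiffAt
    (e.open_source.mem_nhds hx)).mdifferentiableAt (by simp)

lemma tangentAt_tangentTransition {q : C2 × C2} (hq : q.1 ∈ overlap e e') :
    tangentAt e' (tangentTransition e e' q) = tangentAt e q := by
  have hbase : ∀ (a b : M) (v w : C2), a = b → v = w →
      (⟨a, v⟩ : HTangent M) = ⟨b, w⟩ := by
    rintro a b v w rfl rfl; rfl
  have hev : (e'.symm ∘ transition e e') =ᶠ[nhds q.1] e.symm := by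
    filter_upwards [(isOpen_overlap e e').mem_nhds hq] with z hz
    exact e'.left_inv hz.2
  have h1 : MDifferentiableAt 𝓘(ℂ, C2) 𝓘(ℂ, C2) (transition e e') q.1 :=
    (differentiableAt_transition he he' hq).mdifferentiableAt
  have h2 : MDifferentiableAt 𝓘(ℂ, C2) 𝓘(ℂ, C2) e'.symm (transition e e' q.1) :=
    mdifferentiableAt_symm he' (transition_mem_overlap hq).1
  have h3 := mfderiv_comp q.1 h2 h1
  have h4 := hev.mfderiv_eq (I := 𝓘(ℂ, C2)) (I' := 𝓘(ℂ, C2))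
  refine hbase _ _ _ _ hev.self_of_nhds ?_
  have h5 := congrArg (fun A : C2 →L[ℂ] C2 => A q.2) (h4.symm.trans h3)
  refine Eq.trans ?_ h5.symm
  rw [mfderiv_eq_fderiv]
  rfl

omit he' in
lemma mfderiv_symm_ne_zero {z η : C2} (hz : z ∈ e.target) (hη : η ≠ 0) :
    (mfderiv 𝓘(ℂ, C2) 𝓘(ℂ, C2) e.symm z η : C2) ≠ 0 := by
  intro h
  have hev : (e ∘ e.symm) =ᶠ[nhds z] id := by
    filter_upwards [e.open_target.mem_nhds hz] with w hw
    exact e.right_inv hw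
  have h3 := mfderiv_comp z (mdifferentiableAt_chart he (e.map_target hz))
    (mdifferentiableAt_symm he hz)
  have h4 := hev.mfderiv_eq (I := 𝓘(ℂ, C2)) (I' := 𝓘(ℂ, C2))
  rw [mfderiv_id] at h4
  have h5 := congrArg (fun A : C2 →L[ℂ] C2 => A η) (h4.symm.trans h3)
  refine hη (h5.trans ?_)
  change mfderiv 𝓘(ℂ, C2) 𝓘(ℂ, C2) e (e.symm z) (mfderiv 𝓘(ℂ, C2) 𝓘(ℂ, C2) e.symm z η) = 0
  rw [show mfderiv 𝓘(ℂ, C2) 𝓘(ℂ, C2) e.symm z η = 0 from h, map_zero]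

end Charts

/-! ### The curvature invariant of a complex Finsler surface -/

section Finsler

variable [ChartedSpace C2 M] [IsManifold 𝓘(ℂ, C2) ω M] {F : HTangent M → ℝ} {e e' : OpenPartialHomeomorph M C2}
  (hF : IsComplexFinsler F) (he : e ∈ holCharts M) (he' : e' ∈ holCharts M)

include hF he in
lemma finslerOn_localL : FinslerOn (localL F e) (slit e.target) where
  isOpen := isOpen_slit e.open_target
  smooth := hF.smooth e he
  pos p hp := by
    refine pow_pos (lt_of_le_of_ne (hF.nonneg _) (Ne.symm fun h => ?_)) 2
    exact mfderiv_symm_ne_zero he hp.1 hp.2 ((hF.eq_zero_iff _ _).1 h)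
  euler p hp := by
    refine euler_of_homogeneous (((hF.smooth e he).contDiffAt
      ((isOpen_slit e.open_target).mem_nhds hp)).differentiableAt (by simp)) fun c => ?_
    have : F (tangentAt e (p.1, c • p.2)) = ‖c‖ * F (tangentAt e p) := by
      rw [tangentAt, tangentAt, ← hF.homogeneous]
      congr 2
      exact map_smul _ c p.2
    rw [localL, localL, this, mul_pow]
  posDef p hp := hF.posDef e he p hp

omit [IsManifold 𝓘(ℂ, C2) ω M] in
include he he' in
lemma localL_tangentTransition {q : C2 × C2} (hq : q.1 ∈ overlap e e') :
    localL F e' (tangentTransition e e' q) = localL F e q := by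
  rw [localL, localL, tangentAt_tangentTransition he he' hq]

include hF he he' in
lemma invK_le_tangentTransition {q : C2 × C2} (hq : q ∈ slit (overlap e e')) :
    (invK (localL F e) q).re ≤ (invK (localL F e') (tangentTransition e e' q)).re :=
  (finslerOn_localL hF he).invK_le_of_holomorphic (finslerOn_localL hF he')
    (isOpen_slit (isOpen_overlap e e')) (contDiffOn_tangentTransition he he')
    (fun _ hp => ⟨(tangentTransition_mem he he' hp).1.1, (tangentTransition_mem he he' hp).2⟩)
    hq ⟨hq.1.1, hq.2⟩ (fun _ hp => (localL_tangentTransition he he' hp.1).symm)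
    (fderiv_tangentTransition_fst he he' hq)

include hF he he' in
/-- The curvature invariant does not depend on the chart. -/
lemma invK_tangentTransition {q : C2 × C2} (hq : q ∈ slit (overlap e e')) :
    invK (localL F e') (tangentTransition e e' q) = invK (localL F e) q := by
  have hq' := tangentTransition_mem he he' hq
  have h1 := invK_le_tangentTransition hF he he' hq
  -- The inverse change of coordinates gives the opposite inequality, and real parts suffice because
  -- K is real.
  have h2 := invK_le_tangentTransition hF he' he hq'
  rw [tangentTransition_tangentTransition he he' hq.1] at h2
  rw [(finslerOn_localL hF he).invK_eq_re ⟨hq.1.1, hq.2⟩,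
    (finslerOn_localL hF he').invK_eq_re ⟨hq'.1.1, hq'.2⟩, le_antisymm h2 h1]

variable (hK : IsWeaklyKahler F) (hR : IsWeaklySymmetric F) (hA : IsNonvanishingA F)

include hF hK hR hA he in
lemma fderiv_invK_eq_zero {p : C2 × C2} (hp : p ∈ slit e.target) :
    fderiv ℝ (invK (localL F e)) p = 0 := by
  have H := finslerOn_localL hF he
  set S : Set C2 := {z | z ∈ e.target ∧ ∀ η : C2, η ≠ 0 → fderiv ℝ (invK (localL F e)) (z, η) = 0}
  have hdense : e.target ⊆ closure S := by
    intro z hz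
    rw [mem_closure_iff]
    intro V hV hzV
    have hV0 : IsOpen (V ∩ e.target) := hV.inter e.open_target
    -- The vector with A ≠ 0 may be given in another chart e₁; dK = 0 on its fibre is carried back
    -- to e by chart independence.
    obtain ⟨e₁, he₁, p₁, hp₁, hx, hne⟩ := hA (e.symm '' (V ∩ e.target))
      (e.symm.isOpen_image_of_subset_source hV0 Set.inter_subset_right) ⟨_, z, ⟨hzV, hz⟩, rfl⟩
    obtain ⟨z₀, hz₀, hz₀x⟩ := hx
    have hlocal := (eventually_fderiv_invK_eq_zero (finslerOn_localL hF he₁)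
      ⟨hK e₁ he₁, hR e₁ he₁⟩ hp₁ hne).self_of_nhds
    have hz₀o : z₀ ∈ overlap e e₁ := by
      refine ⟨hz₀.2, ?_⟩
      rw [Set.mem_preimage, hz₀x]
      exact e₁.map_target hp₁.1
    have htr : transition e e₁ z₀ = p₁.1 := by
      rw [transition, hz₀x, e₁.right_inv hp₁.1]
    refine ⟨z₀, hz₀.1, hz₀.2, fun η hη => ?_⟩
    have hq : (z₀, η) ∈ slit (overlap e e₁) := ⟨hz₀o, hη⟩
    have hopen := isOpen_slit (isOpen_overlap e e₁)
    have hTq := tangentTransition_mem he he₁ hq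
    have heq : invK (localL F e) =ᶠ[nhds (z₀, η)]
        invK (localL F e₁) ∘ tangentTransition e e₁ := by
      filter_upwards [hopen.mem_nhds hq] with q hq
      exact (invK_tangentTransition hF he he₁ hq).symm
    have hT : DifferentiableAt ℝ (tangentTransition e e₁) (z₀, η) :=
      (((contDiffOn_tangentTransition he he₁).contDiffAt
        (hopen.mem_nhds hq)).differentiableAt (by norm_num)).restrictScalars ℝ
    have hd : DifferentiableAt ℝ (invK (localL F e₁)) (tangentTransition e e₁ (z₀, η)) :=
      differentiableAt_of_smoothOn (finslerOn_localL hF he₁).isOpen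
        (finslerOn_localL hF he₁).contDiffOn_invK ⟨hTq.1.1, hTq.2⟩
    have hzero : fderiv ℝ (invK (localL F e₁)) (tangentTransition e e₁ (z₀, η)) = 0 := by
      have : tangentTransition e e₁ (z₀, η) = (p₁.1, (tangentTransition e e₁ (z₀, η)).2) :=
        Prod.ext htr rfl
      rw [this]
      exact hlocal _ hTq.2
    rw [heq.fderiv_eq, fderiv_comp _ hd hT, hzero, ContinuousLinearMap.zero_comp]
  have hcont : ContinuousOn (fun z => fderiv ℝ (invK (localL F e)) (z, p.2)) e.target :=
    (H.contDiffOn_invK.continuousOn_fderiv_of_isOpen H.isOpen (by simp)).comp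
      (by fun_prop) fun z hz => ⟨hz, hp.2⟩
  have hEq : Set.EqOn (fun z => fderiv ℝ (invK (localL F e)) (z, p.2)) (fun _ => 0) S :=
    fun z hz => hz.2 _ hp.2
  exact hEq.of_subset_closure hcont continuousOn_const (fun z hz => hz.1) hdense hp.1

lemma isPreconnected_slit {U : Set C2} (hU : IsPreconnected U) : IsPreconnected (slit U) := by
  have hrank : 1 < Module.rank ℝ C2 := by
    rw [rank_real_of_complex, rank_fin_fun]
    norm_num
  have : slit U = U ×ˢ ({0}ᶜ : Set C2) := by
    ext q; rfl
  rw [this]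
  exact hU.prod (isConnected_compl_singleton_of_one_lt_rank hrank 0).isPreconnected

include hF hK hR hA he in
lemma exists_nhds_invK_const {z : C2} (hz : z ∈ e.target) : ∃ B, IsOpen B ∧ z ∈ B ∧
    B ⊆ e.target ∧ ∀ p ∈ slit B, ∀ q ∈ slit B,
      invK (localL F e) p = invK (localL F e) q := by
  obtain ⟨r, hr, hB⟩ := Metric.isOpen_iff.1 e.open_target z hz
  refine ⟨Metric.ball z r, Metric.isOpen_ball, Metric.mem_ball_self hr, hB, fun p hp q hq => ?_⟩
  have H := finslerOn_localL hF he
  have hsub : slit (Metric.ball z r) ⊆ slit e.target := fun q hq => ⟨hB hq.1, hq.2⟩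
  exact (isOpen_slit Metric.isOpen_ball).is_const_of_fderiv_eq_zero (𝕜 := ℝ)
    (isPreconnected_slit (convex_ball z r).isPreconnected)
    ((H.contDiffOn_invK.mono hsub).differentiableOn (by simp))
    (fun q hq => fderiv_invK_eq_zero hF he hK hR hA (hsub hq)) hp hq

/-- The curvature invariant of a point of the surface. -/
def pointK (F : HTangent M → ℝ) (x : M) : ℂ :=
  -- The all-ones vector is an arbitrary nonzero choice, harmless once K is known to be constant on
  -- fibres.
  invK (localL F (chartAt C2 x)) (chartAt C2 x x, fun _ => 1)

include hF hK hR hA he in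
lemma invK_eq_pointK {p : C2 × C2} (hp : p ∈ slit e.target) :
    invK (localL F e) p = pointK F (e.symm p.1) := by
  have he' : chartAt C2 (e.symm p.1) ∈ holCharts M := IsManifold.chart_mem_maximalAtlas _
  have hq : p ∈ slit (overlap e (chartAt C2 (e.symm p.1))) :=
    ⟨⟨hp.1, mem_chart_source C2 (e.symm p.1)⟩, hp.2⟩
  obtain ⟨B, -, hzB, -, hconst⟩ := exists_nhds_invK_const hF he' hK hR hA
    (mem_chart_target C2 (e.symm p.1))
  rw [← invK_tangentTransition hF he he' hq]
  refine hconst _ ⟨hzB, (tangentTransition_mem he he' hq).2⟩ _ ⟨hzB, fun h => ?_⟩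
  exact one_ne_zero (congrFun h 0)

include hF hK hR hA in
lemma isLocallyConstant_pointK : IsLocallyConstant (pointK F) := by
  refine (IsLocallyConstant.iff_eventually_eq _).2 fun x => ?_
  have he' : chartAt C2 x ∈ holCharts M := IsManifold.chart_mem_maximalAtlas _
  obtain ⟨B, hBo, hzB, hBt, hconst⟩ := exists_nhds_invK_const hF he' hK hR hA
    (mem_chart_target C2 x)
  have hone : (fun _ => 1 : C2) ≠ 0 := fun h => one_ne_zero (congrFun h 0)
  filter_upwards [((chartAt C2 x).isOpen_inter_preimage hBo).mem_nhds
    ⟨mem_chart_source C2 x, hzB⟩] with y hy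
  have h1 := invK_eq_pointK hF he' hK hR hA (p := (chartAt C2 x y, fun _ => 1))
    ⟨hBt hy.2, hone⟩
  rw [(chartAt C2 x).left_inv hy.1] at h1
  rw [← h1]
  exact hconst (chartAt C2 x y, fun _ => 1) ⟨hy.2, hone⟩ (chartAt C2 x x, fun _ => 1) ⟨hzB, hone⟩

end Finsler

end CFinsler
end

theorem theorem4p8 {M : Type*} [TopologicalSpace M] [ChartedSpace CFinsler.C2 M]
    [IsManifold 𝓘(ℂ, CFinsler.C2) ω M] [ConnectedSpace M]
    (F : CFinsler.HTangent M → ℝ) (hF : CFinsler.IsComplexFinsler F)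
    (hK : CFinsler.IsWeaklyKahler F) (hR : CFinsler.IsWeaklySymmetric F)
    (hA : CFinsler.IsNonvanishingA F) :
    ∃ c : ℝ, ∀ e ∈ CFinsler.holCharts M, ∀ p ∈ CFinsler.slitDomain e,
      CFinsler.invK (CFinsler.localL F e) p = (c : ℂ) ∧
      CFinsler.holSecCurv (CFinsler.localL F e) p = 2 * (c : ℂ) := by
  obtain ⟨x₀⟩ := (inferInstance : Nonempty M)
  refine ⟨(CFinsler.pointK F x₀).re, fun e he p hp => ?_⟩
  have H := CFinsler.finslerOn_localL hF he
  have h1 : CFinsler.invK (CFinsler.localL F e) p = CFinsler.pointK F x₀ := by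
    rw [CFinsler.invK_eq_pointK hF he hK hR hA hp]
    exact (CFinsler.isLocallyConstant_pointK hF hK hR hA).apply_eq_of_preconnectedSpace _ _
  have h2 : CFinsler.invK (CFinsler.localL F e) p = ((CFinsler.pointK F x₀).re : ℂ) := by
    rw [← h1]; exact H.invK_eq_re hp
  exact ⟨h2, by rw [H.holSecCurv_eq hp, h2]⟩
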